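/- For $t\in\mathbb{R}$ let $W(t)=e^{-t\partial_x\Delta}$ be the unitary operator on $L^2(\mathbb{R}^3)$ (coordinates $(x,y_1,y_2)$) given by the Fourier multiplier $e^{it\xi(\xi^2+\eta_1^2+\eta_2^2)}$, where $(\xi,\eta_1,\eta_2)$ are the frequency variables dual to $(x,y_1,y_2)$. Let $\varphi(x,y_1,y_2)=e^{-2\sqrt{x^2+y_1^2+y_2^2}}$ and $$u_0=\sum_{k\ge 1}\ \sum_{\substack{j\ge 1\\ \gcd(j,k)=1}} e^{-e^{k}}e^{-j^2}\,W\!\left(-\tfrac{j}{k}\right)\varphi .$$ Call an irrational number $\gamma$ generic if there is $c>0$ such that $|k_1+k_2\gamma|\ge \dfrac{c}{(|k_1|+|k_2|)\ln(|k_1|+|k_2|)}$ for all $k_1,k_2\in\mathbb{Z}$ with $|k_1|+|k_2|\ge 2$. A function in $L^2(\mathbb{R}^3)$ is said to be $C^n$ on an open set if it agrees almost everywhere there with a $C^n$ function. Then the series defining $u_0$ converges unconditionally in $L^2(\mathbb{R}^3)$, $u_0\in C^\infty(\mathbb{R}^3)$, and there is a set $X\subset\mathbb{R}$ of Lebesgue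 measure zero that contains all rational numbers and no generic irrational number, such that 1. $W(t)u_0\in C^\infty(\mathbb{R}^3)$ for every $t>0$ with $t\notin X$; 2. $W(t)u_0\in C^\infty(\mathbb{R}^3\setminus\{0\})$ and $W(t)u_0\notin C^1(\mathbb{R}^3)$ for every rational $t>0$. -/

import Mathlib

open MeasureTheory
open scoped FourierTransform ContDiff

noncomputable section

namespace ZK

/-- The space `ℝ³`; coordinate `0` is `x` and coordinates `1`, `2` are `y₁`, `y₂`. -/
abbrev R3 : Type := EuclideanSpace ℝ (Fin 3)

/-- The complex Hilbert space `L²(ℝ³)`. -/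
abbrev L2 : Type := Lp (α := R3) ℂ 2 volume

/-- The Fourier symbol of `∂ₓ Δ`. With the convention `f̂(ξ) = ∫ e^{-2πi⟨v,ξ⟩} f(v) dv`
the derivative in the `j`-th variable has symbol `2πi ξⱼ`. -/
def symbol (ξ : R3) : ℂ :=
  (2 * Real.pi * Complex.I * (ξ 0 : ℂ)) * ∑ j : Fin 3, (2 * Real.pi * Complex.I * (ξ j : ℂ)) ^ 2

/-- The Fourier multiplier of `W(t) = e^{-t ∂ₓ Δ}`. -/
def multiplier (t : ℝ) (ξ : R3) : ℂ := Complex.exp (-(t : ℂ) * symbol ξ)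

lemma continuous_multiplier (t : ℝ) : Continuous (multiplier t) := by
  unfold multiplier symbol
  fun_prop

lemma norm_multiplier (t : ℝ) (ξ : R3) : ‖multiplier t ξ‖ = 1 := by
  have h : -(t : ℂ) * symbol ξ =
      ((t * (2 * Real.pi * ξ 0) * ∑ j : Fin 3, (2 * Real.pi * ξ j) ^ 2 : ℝ) : ℂ) * Complex.I := by
    unfold symbol
    simp only [mul_pow, Complex.I_sq, Fin.sum_univ_three]
    push_cast
    ring
  rw [multiplier, h, Complex.norm_exp_ofReal_mul_I]

lemma memLp_multiplier_mul (t : ℝ) (f : L2) :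
    MemLp (fun ξ : R3 => multiplier t ξ * f ξ) 2 volume :=
  (memLp_congr_norm
    ((continuous_multiplier t).aestronglyMeasurable.mul (Lp.aestronglyMeasurable f))
    (Lp.aestronglyMeasurable f)
    (Filter.Eventually.of_forall fun ξ => by simp [norm_multiplier])).2 (Lp.memLp f)

/-- The linear propagator `W(t) = e^{-t ∂ₓ Δ}` on `L²(ℝ³)`:
`W(t) f = 𝓕⁻¹ (e^{-t · symbol} · 𝓕 f)`. -/
def W (t : ℝ) (f : L2) : L2 := 𝓕⁻ ((memLp_multiplier_mul t (𝓕 f)).toLp _ : L2)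

/-- `φ(x, y₁, y₂) = e^{-2 √(x² + y₁² + y₂²)}`. -/
def phiFun (v : R3) : ℂ := (Real.exp (-2 * ‖v‖) : ℂ)

lemma memLp_phiFun : MemLp phiFun 2 volume := by
  have hc : Continuous phiFun := by unfold phiFun; fun_prop
  rw [memLp_two_iff_integrable_sq_norm hc.aestronglyMeasurable]
  have hi : Integrable (fun v : R3 => (1 + ‖v‖) ^ (-(4 : ℝ))) volume :=
    integrable_one_add_norm (by simp; norm_num)
  refine hi.mono' (hc.norm.pow 2).aestronglyMeasurable (Filter.Eventually.of_forall fun v => ?_)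
  have h0 : (0 : ℝ) < 1 + ‖v‖ := by positivity
  have h1 : 1 + ‖v‖ ≤ Real.exp ‖v‖ := by linarith [Real.add_one_le_exp ‖v‖]
  have h2 : ‖phiFun v‖ ^ 2 = ((Real.exp ‖v‖) ^ 4)⁻¹ := by
    rw [phiFun, Complex.norm_real, Real.norm_eq_abs, Real.abs_exp, ← Real.exp_nat_mul,
      ← Real.exp_nat_mul, ← Real.exp_neg]
    congr 1
    push_cast
    ring
  have h3 : (1 + ‖v‖) ^ (-(4 : ℝ)) = ((1 + ‖v‖) ^ 4)⁻¹ := by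
    rw [Real.rpow_neg h0.le]
    norm_cast
  rw [Real.norm_of_nonneg (by positivity), h2, h3]
  gcongr

/-- `φ` as an element of `L²(ℝ³)`. -/
def phi : L2 := memLp_phiFun.toLp phiFun

/-- Pairs `(k, j)` of coprime positive integers. -/
abbrev CoprimePair : Type := {p : ℕ+ × ℕ+ // Nat.Coprime (p.2 : ℕ) (p.1 : ℕ)}

/-- The term `e^{-e^k} e^{-j²} W(-j/k) φ` belonging to the pair `(k, j)`. -/
def term (p : CoprimePair) : L2 :=
  ((Real.exp (-Real.exp ((p.1.1 : ℕ) : ℝ)) * Real.exp (-(((p.1.2 : ℕ) : ℝ) ^ 2)) : ℝ) : ℂ) •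
    W (-(((p.1.2 : ℕ) : ℝ) / ((p.1.1 : ℕ) : ℝ))) phi

/-- The initial datum `u₀ = ∑_{k ≥ 1} ∑_{j ≥ 1, gcd(j,k) = 1} e^{-e^k} e^{-j²} W(-j/k) φ`,
the series being taken in `L²(ℝ³)`. -/
def u0 : L2 := ∑' p : CoprimePair, term p

/-- `f ∈ Cⁿ(U)`: on `U`, the `L²` function `f` coincides almost everywhere with a function of
class `Cⁿ` on `U`. -/
def IsCnOn (n : ℕ∞) (f : L2) (U : Set R3) : Prop :=
  ∃ g : R3 → ℂ, ContDiffOn ℝ n g U ∧ ∀ᵐ v ∂(volume.restrict U), f v = g v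

/-- Generic irrational numbers: `|k₁ + k₂ γ| ≳ 1 / ((|k₁| + |k₂|) ln (|k₁| + |k₂|))` for integers
`k₁`, `k₂`, where the right-hand side makes sense, that is for `|k₁| + |k₂| ≥ 2`. -/
def IsGeneric (γ : ℝ) : Prop :=
  Irrational γ ∧ ∃ c : ℝ, 0 < c ∧ ∀ k₁ k₂ : ℤ, 2 ≤ |k₁| + |k₂| →
    c / (((|k₁| + |k₂| : ℤ) : ℝ) * Real.log ((|k₁| + |k₂| : ℤ) : ℝ)) ≤ |(k₁ : ℝ) + (k₂ : ℝ) * γ|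

end ZK

end

/-! The Fourier transform `π / (1 + π²|ξ|²)²` of `φ` is holomorphic in the first frequency on the
strip `|Im z| < 1/π`. On the line `Im z = β` the multiplier of `W(s)` has modulus `exp(-sβ(2π)³(3x²
+ a² + b² - β²))`, which is Gaussian decay as soon as `sβ > 0`. Shifting the contour to `β =
±1/(2π)`, with the sign of `s`, therefore writes `W(s)φ` as `e^{∓x}` times a smooth function whose
`k`-th derivatives are at most `C_k e^{2|s|} |s|^{-k}` (`fourierInv_multiplier_phiHat`,
`norm_iteratedFDeriv_shifted_le`).

In `W(t)u₀` the term `(k, j)` has evolved for the time `s = t - j/k`. If `|s|⁻¹` is at most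
polynomial in `k` whenever `s ≠ 0` (`Diophantine`), the weights `e^{-e^k} e^{-j²}` make all series
of derivatives converge. Hence `W(t)u₀` is a smooth function plus a nonnegative multiple of `φ`,
coming from the terms with `t = j/k` (`W_u0_ae_eq_regularPart_add`). The multiple is positive
exactly at positive rationals, and `φ` is smooth away from `0` but not differentiable there.

Every rational and every non-Liouville number is Diophantine in this sense, and generic numbers are
not Liouville, so `X` can be the rationals together with the Liouville numbers. -/

namespace ZK

/-! ### Pointwise representatives of `L²` objects. -/

/-- On `L¹ ∩ L²` the inverse Fourier transform of `L²` is given by the Fourier integral. -/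
theorem fourierInv_toLp_ae_eq {E : Type*} [NormedAddCommGroup E] [InnerProductSpace ℝ E]
    [FiniteDimensional ℝ E] [MeasurableSpace E] [BorelSpace E] {g : E → ℂ}
    (h1 : Integrable g) (h2 : MemLp g 2 volume) :
    ((𝓕⁻ (h2.toLp g) : Lp (α := E) ℂ 2 volume) : E → ℂ) =ᵐ[volume] 𝓕⁻ g := by
  have hcont : Continuous (𝓕⁻ g) :=
    VectorFourier.fourierIntegral_continuous (L := -innerₗ E) Real.continuous_fourierChar
      (by simpa using! continuous_inner.neg) h1
  refine ae_eq_of_integral_contDiff_smul_eq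
    ((Lp.memLp _).locallyIntegrable (by norm_num)) hcont.locallyIntegrable ?_
  intro h h_smooth h_cpt
  have hg₁ : HasCompactSupport (Complex.ofRealCLM ∘ h) := h_cpt.comp_left rfl
  have hg₂ : ContDiff ℝ ∞ (Complex.ofRealCLM ∘ h) := by fun_prop
  set H := hg₁.toSchwartzMap hg₂ with hH
  have e1 : ∫ x, h x • (𝓕⁻ (h2.toLp g) : Lp (α := E) ℂ 2 volume) x =
      Lp.toTemperedDistribution (𝓕⁻ (h2.toLp g) : Lp (α := E) ℂ 2 volume) H := by
    simp [hH, Lp.toTemperedDistribution_apply]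
  have e2 : Lp.toTemperedDistribution (𝓕⁻ (h2.toLp g) : Lp (α := E) ℂ 2 volume) H =
      ∫ x, (𝓕⁻ (H : E → ℂ)) x • g x := by
    rw [← Lp.fourierInv_toTemperedDistribution_eq, TemperedDistribution.fourierInv_apply,
      Lp.toTemperedDistribution_apply]
    apply integral_congr_ae
    filter_upwards [h2.coeFn_toLp] with x hx
    rw [hx, SchwartzMap.fourierInv_coe]
  -- The transform moves from the test function to `g` by Fubini; the kernel is symmetric in its two
  -- variables.
  have e3 : ∫ x, (𝓕⁻ (H : E → ℂ)) x • g x = ∫ x, H x • 𝓕⁻ g x := by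
    have := VectorFourier.integral_fourierIntegral_smul_eq_flip (L := -innerₗ E) (μ := volume)
      (ν := volume) Real.continuous_fourierChar (by simpa using! continuous_inner.neg)
      (f := H) (g := g) H.integrable h1
    have hflip : (-innerₗ E).flip = -innerₗ E := by
      ext x y; simp [real_inner_comm]
    rw [hflip] at this
    exact this
  rw [e1, e2, e3]
  simp [hH]

/-- A series that converges both in `L²` and pointwise has the pointwise sum. -/
theorem tsum_ae_eq_of_hasSum {α ι : Type*} [Countable ι] [MeasurableSpace α] {μ : Measure α}
    {F : ι → Lp ℂ 2 μ} {f : ι → α → ℂ} {h : α → ℂ} (hF : Summable F)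
    (hf : ∀ i, F i =ᵐ[μ] f i) (hh : ∀ x, HasSum (fun i => f i x) (h x)) :
    ((∑' i, F i : Lp ℂ 2 μ) : α → ℂ) =ᵐ[μ] h := by
  have h1 : Filter.Tendsto (fun s : Finset ι => ∑ i ∈ s, F i) Filter.atTop (nhds (∑' i, F i)) :=
    hF.hasSum
  -- `L²` convergence gives convergence in measure, hence a.e. convergence along a sequence of
  -- finite sets, which suffices to identify the limit.
  obtain ⟨ns, hns, hae⟩ := (tendstoInMeasure_of_tendsto_Lp h1).exists_seq_tendsto_ae'
  have hsum : ∀ᵐ x ∂μ, ∀ n, (∑ i ∈ ns n, F i : Lp ℂ 2 μ) x = ∑ i ∈ ns n, f i x := by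
    rw [ae_all_iff]
    intro n
    have hall : ∀ᵐ x ∂μ, ∀ i, F i x = f i x := ae_all_iff.2 hf
    filter_upwards [Lp.coeFn_finsetSum (ns n) F, hall] with x hx hx'
    rw [hx]
    simp [hx']
  filter_upwards [hae, hsum] with x hx hs
  simp only [hs] at hx
  exact tendsto_nhds_unique hx ((hh x).comp hns)

/-! ### The propagator as a one-parameter group of isometries. -/

theorem W_ae_eq (t : ℝ) {f : L2} {g : R3 → ℂ} (h1 : Integrable g) (h2 : MemLp g 2 volume)
    (hf : f = 𝓕⁻ (h2.toLp g : L2)) :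
    (W t f : R3 → ℂ) =ᵐ[volume] 𝓕⁻ (fun ξ => multiplier t ξ * g ξ) := by
  have hm2 : MemLp (fun ξ => multiplier t ξ * g ξ) 2 volume :=
    (memLp_congr_norm ((continuous_multiplier t).aestronglyMeasurable.mul h2.1) h2.1
      (Filter.Eventually.of_forall fun ξ => by simp [norm_multiplier])).2 h2
  have hm1 : Integrable (fun ξ => multiplier t ξ * g ξ) :=
    h1.mono ((continuous_multiplier t).aestronglyMeasurable.mul h2.1)
      (Filter.Eventually.of_forall fun ξ => by simp [norm_multiplier])
  have : W t f = 𝓕⁻ (hm2.toLp _ : L2) := by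
    rw [W]
    congr 1
    rw [MemLp.toLp_eq_toLp_iff, hf, FourierTransform.fourier_fourierInv_eq]
    filter_upwards [h2.coeFn_toLp] with x hx
    rw [hx]
  rw [this]
  exact fourierInv_toLp_ae_eq hm1 hm2

theorem fourier_W (t : ℝ) (f : L2) :
    𝓕 (W t f) = ((memLp_multiplier_mul t (𝓕 f)).toLp _ : L2) := by
  rw [W, FourierTransform.fourier_fourierInv_eq]

theorem multiplier_add (s t : ℝ) (ξ : R3) :
    multiplier (s + t) ξ = multiplier s ξ * multiplier t ξ := by
  rw [multiplier, multiplier, multiplier, ← Complex.exp_add]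
  congr 1
  push_cast
  ring

theorem W_W (s t : ℝ) (f : L2) : W s (W t f) = W (s + t) f := by
  rw [W, W]
  congr 1
  rw [MemLp.toLp_eq_toLp_iff, FourierTransform.fourier_fourierInv_eq]
  filter_upwards [(memLp_multiplier_mul t (𝓕 f)).coeFn_toLp] with x hx
  rw [hx, multiplier_add, mul_assoc]

/-- The propagator as a linear isometry. -/
noncomputable def Wₗᵢ (t : ℝ) : L2 →ₗᵢ[ℂ] L2 where
  toFun := W t
  map_add' f g := by
    rw [W, W, W, ← FourierTransform.fourierInv_add, ← MemLp.toLp_add]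
    congr 1
    rw [MemLp.toLp_eq_toLp_iff, FourierTransform.fourier_add]
    filter_upwards [Lp.coeFn_add (𝓕 f) (𝓕 g)] with x hx
    rw [hx, Pi.add_apply, Pi.add_apply, mul_add]
  map_smul' c f := by
    rw [W, W, RingHom.id_apply, ← FourierTransform.fourierInv_smul, ← MemLp.toLp_const_smul]
    congr 1
    rw [MemLp.toLp_eq_toLp_iff, FourierTransform.fourier_smul]
    filter_upwards [Lp.coeFn_smul c (𝓕 f)] with x hx
    simp only [hx, Pi.smul_apply, smul_eq_mul]
    ring
  norm_map' f := by
    change ‖W t f‖ = ‖f‖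
    rw [← Lp.norm_fourier_eq (W t f), fourier_W, ← Lp.norm_fourier_eq f]
    rw [Lp.norm_toLp, Lp.norm_def]
    congr 1
    exact eLpNorm_congr_norm_ae (Filter.Eventually.of_forall fun ξ => by simp [norm_multiplier])

/-! ### The Fourier transform of `φ`. -/

/-- The splitting `ℝ³ = ℝ × (ℝ × ℝ)`. -/
noncomputable def splitEquiv : R3 ≃ᵐ ℝ × (ℝ × ℝ) :=
  (MeasurableEquiv.toLp 2 (Fin 3 → ℝ)).symm.trans
    ((MeasurableEquiv.piFinSuccAbove (fun _ => ℝ) 0).trans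
      ((MeasurableEquiv.refl ℝ).prodCongr MeasurableEquiv.finTwoArrow))

theorem measurePreserving_splitEquiv : MeasurePreserving splitEquiv := by
  refine (EuclideanSpace.volume_preserving_symm_measurableEquiv_toLp (Fin 3)).trans ?_
  refine (volume_preserving_piFinSuccAbove (fun _ : Fin 3 => ℝ) 0).trans ?_
  exact (MeasurePreserving.id volume).prod (volume_preserving_finTwoArrow ℝ)

theorem integral_coords (f : ℝ × ℝ × ℝ → ℂ) : ∫ ξ : R3, f (ξ 0, ξ 1, ξ 2) = ∫ p, f p :=
  measurePreserving_splitEquiv.integral_comp splitEquiv.measurableEmbedding f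

theorem integrable_coords {f : ℝ × ℝ × ℝ → ℂ} :
    Integrable (fun ξ : R3 => f (ξ 0, ξ 1, ξ 2)) ↔ Integrable f :=
  measurePreserving_splitEquiv.integrable_comp_emb splitEquiv.measurableEmbedding

theorem norm_sq_R3 (ξ : R3) : ‖ξ‖ ^ 2 = ξ 0 ^ 2 + ξ 1 ^ 2 + ξ 2 ^ 2 := by
  rw [EuclideanSpace.real_norm_sq_eq, Fin.sum_univ_three]

theorem inner_R3 (ξ v : R3) : inner ℝ ξ v = ξ 0 * v 0 + ξ 1 * v 1 + ξ 2 * v 2 := by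
  rw [PiLp.inner_apply, Fin.sum_univ_three]
  simp [mul_comm]

/-- The Fourier transform of `φ`, extended to complex values of the first frequency. -/
noncomputable def phiHat (z : ℂ) (a b : ℝ) : ℂ :=
  Real.pi / (1 + (Real.pi : ℂ) ^ 2 * (z ^ 2 + a ^ 2 + b ^ 2)) ^ 2

theorem phiHat_real (ξ : R3) :
    phiHat (ξ 0) (ξ 1) (ξ 2) = ((Real.pi / (1 + Real.pi ^ 2 * ‖ξ‖ ^ 2) ^ 2 : ℝ) : ℂ) := by
  rw [phiHat, norm_sq_R3]
  push_cast
  rfl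

theorem continuous_phiHat_real : Continuous fun ξ : R3 => phiHat (ξ 0) (ξ 1) (ξ 2) := by
  simp_rw [phiHat_real]
  refine Complex.continuous_ofReal.comp (Continuous.div (by fun_prop) (by fun_prop) fun ξ => ?_)
  positivity

theorem integrable_one_add_norm_sq :
    Integrable fun ξ : R3 => ((1 + ‖ξ‖ ^ 2) ^ 2)⁻¹ := by
  have := integrable_rpow_neg_one_add_norm_sq (E := R3) (μ := volume) (r := 4)
    (by simp; norm_num)
  refine this.congr (Filter.Eventually.of_forall fun ξ => ?_)
  have h0 : (0 : ℝ) ≤ 1 + ‖ξ‖ ^ 2 := by positivity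
  norm_num [Real.rpow_neg h0]

theorem norm_phiHat_real_le (ξ : R3) :
    ‖phiHat (ξ 0) (ξ 1) (ξ 2)‖ ≤ Real.pi * ((1 + ‖ξ‖ ^ 2) ^ 2)⁻¹ := by
  rw [phiHat_real, Complex.norm_real, Real.norm_of_nonneg (by positivity), div_eq_mul_inv]
  have : (1 : ℝ) ≤ Real.pi ^ 2 := by nlinarith [Real.pi_gt_three]
  gcongr
  nlinarith [sq_nonneg ‖ξ‖]

theorem integrable_phiHat : Integrable fun ξ : R3 => phiHat (ξ 0) (ξ 1) (ξ 2) :=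
  (integrable_one_add_norm_sq.const_mul Real.pi).mono' continuous_phiHat_real.aestronglyMeasurable
    (Filter.Eventually.of_forall norm_phiHat_real_le)

theorem memLp_phiHat : MemLp (fun ξ : R3 => phiHat (ξ 0) (ξ 1) (ξ 2)) 2 volume := by
  rw [memLp_two_iff_integrable_sq_norm continuous_phiHat_real.aestronglyMeasurable]
  refine (integrable_one_add_norm_sq.const_mul (Real.pi ^ 2)).mono'
    (continuous_phiHat_real.norm.pow 2).aestronglyMeasurable
    (Filter.Eventually.of_forall fun ξ => ?_)
  have h1 := norm_phiHat_real_le ξ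
  have h2 : ((1 + ‖ξ‖ ^ 2) ^ 2)⁻¹ ≤ 1 := inv_le_one_of_one_le₀ (by nlinarith [sq_nonneg ‖ξ‖])
  have h3 : 0 ≤ ((1 + ‖ξ‖ ^ 2) ^ 2)⁻¹ := by positivity
  rw [Real.norm_of_nonneg (by positivity)]
  calc ‖phiHat (ξ 0) (ξ 1) (ξ 2)‖ ^ 2 ≤ (Real.pi * ((1 + ‖ξ‖ ^ 2) ^ 2)⁻¹) ^ 2 := by gcongr
    _ = Real.pi ^ 2 * (((1 + ‖ξ‖ ^ 2) ^ 2)⁻¹ * ((1 + ‖ξ‖ ^ 2) ^ 2)⁻¹) := by ring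
    _ ≤ Real.pi ^ 2 * (((1 + ‖ξ‖ ^ 2) ^ 2)⁻¹ * 1) := by gcongr
    _ = _ := by ring

theorem integrable_exp_neg_two_abs : Integrable fun x : ℝ => ((Real.exp (-2 * |x|) : ℝ) : ℂ) := by
  suffices h : Integrable fun x : ℝ => Real.exp (-2 * |x|) from h.ofReal
  rw [← integrableOn_univ, ← Set.Iic_union_Ioi (a := (0 : ℝ)), integrableOn_union]
  constructor
  · refine (integrableOn_exp_mul_Iic (a := 2) (by norm_num) 0).congr_fun (fun x hx => ?_)
      measurableSet_Iic
    simp [abs_of_nonpos (Set.mem_Iic.1 hx)]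
  · refine (integrableOn_exp_mul_Ioi (a := -2) (by norm_num) 0).congr_fun (fun x hx => ?_)
      measurableSet_Ioi
    simp [abs_of_pos (Set.mem_Ioi.1 hx)]

theorem fourier_exp_neg_two_abs (τ : ℝ) :
    𝓕 (fun x : ℝ => ((Real.exp (-2 * |x|) : ℝ) : ℂ)) τ =
      ((1 / (1 + Real.pi ^ 2 * τ ^ 2) : ℝ) : ℂ) := by
  have hint : Integrable fun x : ℝ => Complex.exp (↑(-2 * Real.pi * x * τ) * Complex.I) •
      ((Real.exp (-2 * |x|) : ℝ) : ℂ) := by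
    refine integrable_exp_neg_two_abs.mono (by fun_prop) (Filter.Eventually.of_forall fun x => ?_)
    rw [norm_smul, Complex.norm_exp_ofReal_mul_I, one_mul]
  rw [Real.fourier_real_eq_integral_exp_smul, ← intervalIntegral.integral_Iic_add_Ioi (b := 0)
    hint.integrableOn hint.integrableOn]
  have e1 : ∫ x in Set.Iic (0 : ℝ), Complex.exp (↑(-2 * Real.pi * x * τ) * Complex.I) •
      ((Real.exp (-2 * |x|) : ℝ) : ℂ) =
      ∫ x in Set.Iic (0 : ℝ), Complex.exp ((2 - 2 * Real.pi * τ * Complex.I) * x) := by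
    refine setIntegral_congr_fun measurableSet_Iic fun x hx => ?_
    simp only [abs_of_nonpos (Set.mem_Iic.1 hx), smul_eq_mul, Complex.ofReal_exp]
    rw [← Complex.exp_add]
    congr 1
    push_cast
    ring
  have e2 : ∫ x in Set.Ioi (0 : ℝ), Complex.exp (↑(-2 * Real.pi * x * τ) * Complex.I) •
      ((Real.exp (-2 * |x|) : ℝ) : ℂ) =
      ∫ x in Set.Ioi (0 : ℝ), Complex.exp ((-2 - 2 * Real.pi * τ * Complex.I) * x) := by
    refine setIntegral_congr_fun measurableSet_Ioi fun x hx => ?_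
    simp only [abs_of_pos (Set.mem_Ioi.1 hx), smul_eq_mul, Complex.ofReal_exp]
    rw [← Complex.exp_add]
    congr 1
    push_cast
    ring
  rw [e1, e2, integral_exp_mul_complex_Iic (by simp), integral_exp_mul_complex_Ioi (by simp)]
  have h1 : (2 - 2 * Real.pi * τ * Complex.I : ℂ) ≠ 0 := fun h => by
    simpa using congrArg Complex.re h
  have h2 : (-2 - 2 * Real.pi * τ * Complex.I : ℂ) ≠ 0 := fun h => by
    simpa using congrArg Complex.re h
  have h3 : (1 + (Real.pi : ℂ) ^ 2 * (τ : ℂ) ^ 2) ≠ 0 := by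
    have : (1 + Real.pi ^ 2 * τ ^ 2 : ℝ) ≠ 0 := by positivity
    exact_mod_cast this
  push_cast
  simp only [mul_zero, Complex.exp_zero]
  rw [div_add_div _ _ h1 h2, div_eq_div_iff (mul_ne_zero h1 h2) h3]
  linear_combination (-4 * (Real.pi : ℂ) ^ 2 * (τ : ℂ) ^ 2) * Complex.I_sq

theorem fourierInv_poisson (x : ℝ) :
    𝓕⁻ (fun τ : ℝ => ((1 / (1 + Real.pi ^ 2 * τ ^ 2) : ℝ) : ℂ)) x =
      ((Real.exp (-2 * |x|) : ℝ) : ℂ) := by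
  have h := funext fourier_exp_neg_two_abs
  rw [← h]
  have hi : Integrable (𝓕 fun x : ℝ => ((Real.exp (-2 * |x|) : ℝ) : ℂ)) := by
    rw [h]
    suffices h : Integrable fun τ : ℝ => 1 / (1 + Real.pi ^ 2 * τ ^ 2) from h.ofReal
    have := integrable_inv_one_add_sq.comp_mul_left' (Real.pi_ne_zero)
    refine this.congr (Filter.Eventually.of_forall fun x => ?_)
    simp [mul_pow]
  rw [Continuous.fourierInv_fourier_eq (by fun_prop) integrable_exp_neg_two_abs hi]

/-- In polar coordinates the radial integrand has the antiderivative `-(1/(2π)) / (A + π²r²)`, with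
`A = 1 + π²x²`. -/
theorem integral_phiHat_plane (x : ℝ) :
    ∫ p : ℝ × ℝ, phiHat x p.1 p.2 = ((1 / (1 + Real.pi ^ 2 * x ^ 2) : ℝ) : ℂ) := by
  have hA : 0 < 1 + Real.pi ^ 2 * x ^ 2 := by positivity
  set A : ℝ := 1 + Real.pi ^ 2 * x ^ 2 with hAdef
  have hrad : ∫ r in Set.Ioi (0 : ℝ), r * (Real.pi / (A + Real.pi ^ 2 * r ^ 2) ^ 2) =
      0 - -(1 / (2 * Real.pi)) / (A + Real.pi ^ 2 * 0 ^ 2) := by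
    refine integral_Ioi_of_hasDerivAt_of_nonneg'
      (g := fun r => -(1 / (2 * Real.pi)) / (A + Real.pi ^ 2 * r ^ 2)) (fun r _ => ?_)
      (fun r hr => ?_) ?_
    · have hp : (A + Real.pi ^ 2 * r ^ 2) ≠ 0 := by positivity
      have hd : HasDerivAt (fun r : ℝ => A + Real.pi ^ 2 * r ^ 2)
          (Real.pi ^ 2 * (2 * r)) r := by
        simpa using ((hasDerivAt_pow 2 r).const_mul (Real.pi ^ 2)).const_add A
      refine ((hasDerivAt_const r (-(1 / (2 * Real.pi)))).div hd hp).congr_deriv ?_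
      field_simp
      ring
    · have := Set.mem_Ioi.1 hr
      positivity
    · refine Filter.Tendsto.const_div_atTop ?_ _
      refine Filter.tendsto_atTop_add_const_left _ _ ?_
      exact (Filter.tendsto_pow_atTop two_ne_zero).const_mul_atTop (by positivity)
  rw [← integral_comp_polarCoord_symm]
  have e : ∀ p : ℝ × ℝ, p.1 • phiHat x (polarCoord.symm p).1 (polarCoord.symm p).2 =
      ((p.1 * (Real.pi / (A + Real.pi ^ 2 * p.1 ^ 2) ^ 2) : ℝ) : ℂ) * 1 := by
    intro p
    have hc : (Complex.cos (p.2 : ℂ)) ^ 2 + (Complex.sin p.2) ^ 2 = 1 := by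
      rw [add_comm]; exact Complex.sin_sq_add_cos_sq _
    simp only [polarCoord, phiHat, hAdef, Complex.real_smul]
    have : (x : ℂ) ^ 2 + ((p.1 * Real.cos p.2 : ℝ) : ℂ) ^ 2 + ((p.1 * Real.sin p.2 : ℝ) : ℂ) ^ 2 =
        x ^ 2 + p.1 ^ 2 := by
      push_cast
      linear_combination (p.1 : ℂ) ^ 2 * hc
    change (p.1 : ℂ) * (Real.pi / (1 + (Real.pi : ℂ) ^ 2 * ((x : ℂ) ^ 2 +
      ((p.1 * Real.cos p.2 : ℝ) : ℂ) ^ 2 + ((p.1 * Real.sin p.2 : ℝ) : ℂ) ^ 2)) ^ 2) = _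
    rw [this]
    push_cast
    ring
  simp_rw [e]
  rw [polarCoord_target, Measure.volume_eq_prod, setIntegral_prod_mul
    (fun r : ℝ => ((r * (Real.pi / (A + Real.pi ^ 2 * r ^ 2) ^ 2) : ℝ) : ℂ)) (fun _ => (1 : ℂ)),
    integral_complex_ofReal, hrad]
  have hv : (volume.real (Set.Ioo (-Real.pi) Real.pi)) = 2 * Real.pi := by
    rw [Real.volume_real_Ioo_of_le (by linarith [Real.pi_pos])]
    ring
  simp only [integral_const, measureReal_restrict_apply_univ, hv]
  rw [Complex.real_smul, mul_one, ← Complex.ofReal_mul]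
  congr 1
  field_simp
  ring

/-- Both sides are radial, so `v` may be moved to the first axis. There the other two frequencies
integrate out and leave the one-dimensional pair `e^{-2|x|}`, `1/(1 + π²τ²)`. -/
theorem fourierInv_phiHat (v : R3) :
    𝓕⁻ (fun ξ : R3 => phiHat (ξ 0) (ξ 1) (ξ 2)) v = phiFun v := by
  set f : R3 → ℂ := fun ξ => phiHat (ξ 0) (ξ 1) (ξ 2) with hf
  set w : R3 := EuclideanSpace.single 0 ‖v‖ with hw
  have hvw : ‖v‖ = ‖w‖ := by simp [hw]
  -- The reflection exchanging `v` and the vector `w` of equal length.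
  set A : R3 ≃ₗᵢ[ℝ] R3 := (Submodule.span ℝ {v - w})ᗮ.reflection with hA
  have hAv : A v = w := Submodule.reflection_sub hvw
  have hfA : f ∘ A = f := by
    funext ξ
    simp only [hf, Function.comp_apply, phiHat_real, LinearIsometryEquiv.norm_map]
  have h1 : 𝓕⁻ f v = 𝓕⁻ f w := by
    rw [← hAv, ← Real.fourierInv_comp_linearIsometry, hfA]
  rw [h1, Real.fourierInv_eq']
  have h2 : ∀ ξ : R3, Complex.exp (↑(2 * Real.pi * inner ℝ ξ w) * Complex.I) • f ξ =
      (fun p : ℝ × ℝ × ℝ => Complex.exp (↑(2 * Real.pi * (p.1 * ‖v‖)) * Complex.I) *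
        phiHat p.1 p.2.1 p.2.2) (ξ 0, ξ 1, ξ 2) := by
    intro ξ
    simp [hf, inner_R3, hw]
  have hint : Integrable (fun p : ℝ × ℝ × ℝ => Complex.exp (↑(2 * Real.pi * (p.1 * ‖v‖)) *
      Complex.I) * phiHat p.1 p.2.1 p.2.2) := by
    rw [← integrable_coords]
    refine integrable_phiHat.mono ?_ (Filter.Eventually.of_forall fun ξ => ?_)
    · exact (Continuous.mul (by fun_prop) continuous_phiHat_real).aestronglyMeasurable
    · rw [norm_mul, Complex.norm_exp_ofReal_mul_I, one_mul]
  refine (integral_congr_ae (Filter.Eventually.of_forall h2)).trans ?_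
  refine (integral_coords (fun p : ℝ × ℝ × ℝ => Complex.exp (↑(2 * Real.pi * (p.1 * ‖v‖)) *
    Complex.I) * phiHat p.1 p.2.1 p.2.2)).trans ?_
  rw [Measure.volume_eq_prod, integral_prod _ hint]
  simp_rw [integral_const_mul]
  simp_rw [integral_phiHat_plane]
  have h3 := fourierInv_poisson ‖v‖
  rw [Real.fourierInv_eq'] at h3
  rw [abs_norm] at h3
  rw [phiFun, ← h3]
  refine integral_congr_ae (Filter.Eventually.of_forall fun x => ?_)
  simp [mul_comm]

theorem phi_eq : phi = 𝓕⁻ (memLp_phiHat.toLp _ : L2) := by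
  rw [Lp.ext_iff]
  refine (memLp_phiFun.coeFn_toLp).trans ?_
  refine Filter.EventuallyEq.trans ?_ (fourierInv_toLp_ae_eq integrable_phiHat memLp_phiHat).symm
  exact Filter.Eventually.of_forall fun v => (fourierInv_phiHat v).symm

/-! ### The contour shift in the first frequency. -/

/-- Shifting the line of integration of a function holomorphic on a horizontal strip. -/
theorem integral_eq_integral_add_mul_I {f : ℂ → ℂ} {β : ℝ} {B : ℝ → ℝ}
    (hf : DifferentiableOn ℂ f {z | z.im ∈ Set.uIcc 0 β})
    (hB : ∀ x y : ℝ, y ∈ Set.uIcc 0 β → ‖f (x + y * Complex.I)‖ ≤ B x)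
    (hBt : Filter.Tendsto B Filter.atTop (nhds 0)) (hBb : Filter.Tendsto B Filter.atBot (nhds 0))
    (h0 : Integrable fun x : ℝ => f x) (h1 : Integrable fun x : ℝ => f (x + β * Complex.I)) :
    ∫ x : ℝ, f x = ∫ x : ℝ, f (x + β * Complex.I) := by
  -- Cauchy's theorem on the rectangle `[-T, T] × [0, β]`; the vertical sides vanish as `T → ∞`.
  have hrect : ∀ T : ℝ, (∫ x in -T..T, f x) - (∫ x in -T..T, f (x + β * Complex.I)) +
      Complex.I • (∫ y in (0 : ℝ)..β, f (T + y * Complex.I)) -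
      Complex.I • (∫ y in (0 : ℝ)..β, f ((-T : ℝ) + y * Complex.I)) = 0 := by
    intro T
    have := Complex.integral_boundary_rect_eq_zero_of_differentiableOn f ((-T : ℝ) : ℂ)
      (T + β * Complex.I) (hf.mono fun z hz => by simpa using hz.2)
    simpa using this
  have hside : ∀ u : ℝ → ℝ, Filter.Tendsto (fun T => B (u T)) Filter.atTop (nhds 0) →
      Filter.Tendsto (fun T => Complex.I • ∫ y in (0 : ℝ)..β, f (u T + y * Complex.I))
        Filter.atTop (nhds 0) := by
    intro u hu
    have hbd : ∀ T, ‖Complex.I • ∫ y in (0 : ℝ)..β, f (u T + y * Complex.I)‖ ≤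
        B (u T) * |β - 0| := by
      intro T
      rw [norm_smul, Complex.norm_I, one_mul]
      exact intervalIntegral.norm_integral_le_of_norm_le_const
        fun y hy => hB _ _ (Set.uIoc_subset_uIcc hy)
    refine squeeze_zero_norm hbd ?_
    simpa using hu.mul_const (|β - 0|)
  have hl := intervalIntegral_tendsto_integral h0 Filter.tendsto_neg_atTop_atBot Filter.tendsto_id
  have hr := intervalIntegral_tendsto_integral h1 Filter.tendsto_neg_atTop_atBot Filter.tendsto_id
  have hall := ((hl.sub hr).add (hside (fun T => T) hBt)).sub
    (hside (fun T => -T) (hBb.comp Filter.tendsto_neg_atTop_atBot))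
  have := tendsto_nhds_unique (hall.congr fun T => hrect T) tendsto_const_nhds
  simpa [sub_eq_zero] using this

/-- The multiplier of `W(s)`, extended to complex values of the first frequency. -/
noncomputable def cmultiplier (s : ℝ) (z : ℂ) (a b : ℝ) : ℂ :=
  Complex.exp (s * (2 * Real.pi) ^ 3 * Complex.I * z * (z ^ 2 + a ^ 2 + b ^ 2))

theorem multiplier_eq (s : ℝ) (ξ : R3) : multiplier s ξ = cmultiplier s (ξ 0) (ξ 1) (ξ 2) := by
  rw [multiplier, cmultiplier, symbol, Fin.sum_univ_three]
  congr 1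
  linear_combination (-(s : ℂ) * (2 * Real.pi) ^ 3 * Complex.I * ξ 0 *
    ((ξ 0 : ℂ) ^ 2 + (ξ 1 : ℂ) ^ 2 + (ξ 2 : ℂ) ^ 2)) * Complex.I_sq

/-- Off the real axis dispersion becomes dissipation: the real part of the exponent is quadratic in
the real frequencies, with a sign governed by `s * y`. -/
theorem norm_cmultiplier (s x y a b : ℝ) : ‖cmultiplier s (x + y * Complex.I) a b‖ =
    Real.exp (-(s * y) * (2 * Real.pi) ^ 3 * (3 * x ^ 2 + a ^ 2 + b ^ 2 - y ^ 2)) := by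
  rw [cmultiplier, Complex.norm_exp]
  congr 1
  have : (s : ℂ) * (2 * Real.pi) ^ 3 * Complex.I * (x + y * Complex.I) *
      ((x + y * Complex.I) ^ 2 + a ^ 2 + b ^ 2) =
      ((-(s * y) * (2 * Real.pi) ^ 3 * (3 * x ^ 2 + a ^ 2 + b ^ 2 - y ^ 2) : ℝ) : ℂ) +
      ((s * (2 * Real.pi) ^ 3 * x * (x ^ 2 - 3 * y ^ 2 + a ^ 2 + b ^ 2) : ℝ) : ℂ) * Complex.I := by
    push_cast
    linear_combination ((s : ℂ) * (2 * Real.pi) ^ 3 * (3 * x * y ^ 2 * Complex.I +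
      y * (3 * x ^ 2 + a ^ 2 + b ^ 2) + y ^ 3 * (Complex.I ^ 2 - 1))) * Complex.I_sq
  rw [this]
  simp only [Complex.add_re, Complex.ofReal_re, Complex.re_ofReal_mul, Complex.I_re, mul_zero,
    add_zero]

/-- The zeros of the denominator have `|Im z| ≥ 1/π`. At half that height `π²y² ≤ 1/4`, which leaves
the factor `3/4`. -/
theorem re_phiHat_den {x y a b : ℝ} (hy : |y| ≤ 1 / (2 * Real.pi)) :
    3 / 4 * (1 + (x ^ 2 + a ^ 2 + b ^ 2)) ≤
      (1 + (Real.pi : ℂ) ^ 2 * ((x + y * Complex.I) ^ 2 + a ^ 2 + b ^ 2)).re := by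
  have : (1 + (Real.pi : ℂ) ^ 2 * ((x + y * Complex.I) ^ 2 + a ^ 2 + b ^ 2)) =
      ((1 + Real.pi ^ 2 * (x ^ 2 - y ^ 2 + a ^ 2 + b ^ 2) : ℝ) : ℂ) +
        ((Real.pi ^ 2 * (2 * x * y) : ℝ) : ℂ) * Complex.I := by
    push_cast
    linear_combination ((Real.pi : ℂ) ^ 2 * y ^ 2) * Complex.I_sq
  rw [this]
  have h1 : Real.pi ^ 2 * y ^ 2 ≤ 1 / 4 := by
    have h2 : Real.pi * |y| ≤ 1 / 2 := by
      calc Real.pi * |y| ≤ Real.pi * (1 / (2 * Real.pi)) := by gcongr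
        _ = 1 / 2 := by field_simp
    have h3 : (Real.pi * |y|) ^ 2 ≤ (1 / 2) ^ 2 := by gcongr
    rw [mul_pow, sq_abs] at h3
    linarith
  have h4 : (1 : ℝ) ≤ Real.pi ^ 2 := by nlinarith [Real.pi_gt_three]
  have h5 : 0 ≤ (Real.pi ^ 2 - 1) * (x ^ 2 + a ^ 2 + b ^ 2) := by
    apply mul_nonneg <;> [linarith; positivity]
  simp only [Complex.add_re, Complex.ofReal_re, Complex.re_ofReal_mul, Complex.I_re, mul_zero,
    add_zero]
  nlinarith [sq_nonneg x, sq_nonneg a, sq_nonneg b]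

theorem phiHat_den_ne_zero {x y a b : ℝ} (hy : |y| ≤ 1 / (2 * Real.pi)) :
    (1 + (Real.pi : ℂ) ^ 2 * ((x + y * Complex.I) ^ 2 + a ^ 2 + b ^ 2)) ≠ 0 := by
  intro h
  have h1 := re_phiHat_den (x := x) (a := a) (b := b) hy
  rw [h, Complex.zero_re] at h1
  nlinarith [sq_nonneg x, sq_nonneg a, sq_nonneg b]

theorem norm_phiHat_le {x y a b : ℝ} (hy : |y| ≤ 1 / (2 * Real.pi)) :
    ‖phiHat (x + y * Complex.I) a b‖ ≤
      2 * Real.pi * ((1 + (x ^ 2 + a ^ 2 + b ^ 2)) ^ 2)⁻¹ := by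
  have h1 := (re_phiHat_den (x := x) (a := a) (b := b) hy).trans (Complex.re_le_norm _)
  have h2 : 0 < 1 + (x ^ 2 + a ^ 2 + b ^ 2) := by positivity
  rw [phiHat, norm_div, norm_pow, Complex.norm_real, Real.norm_of_nonneg Real.pi_pos.le]
  calc Real.pi / _ ^ 2 ≤ Real.pi / (3 / 4 * (1 + (x ^ 2 + a ^ 2 + b ^ 2))) ^ 2 := by gcongr
    _ = 16 / 9 * (Real.pi * ((1 + (x ^ 2 + a ^ 2 + b ^ 2)) ^ 2)⁻¹) := by
      field_simp; norm_num
    _ ≤ 2 * (Real.pi * ((1 + (x ^ 2 + a ^ 2 + b ^ 2)) ^ 2)⁻¹) := by gcongr; norm_num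
    _ = _ := by ring

theorem norm_cmultiplier_le {s x y a b : ℝ} (hy : |y| ≤ 1 / (2 * Real.pi)) (hs : 0 ≤ s * y) :
    ‖cmultiplier s (x + y * Complex.I) a b‖ ≤
      Real.exp |s| * Real.exp (-(s * y) * (2 * Real.pi) ^ 3 * (x ^ 2 + a ^ 2 + b ^ 2)) := by
  rw [norm_cmultiplier, ← Real.exp_add]
  apply Real.exp_le_exp.2
  -- The only growing contribution is the one cubic in `y`, and `2π|y| ≤ 1` bounds it by `|s|`.
  have h1 : (s * y) * (2 * Real.pi) ^ 3 * y ^ 2 ≤ |s| := by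
    have e : (s * y) * (2 * Real.pi) ^ 3 * y ^ 2 = |s| * (2 * Real.pi * |y|) ^ 3 := by
      have e1 : s * y = |s| * |y| := by rw [← abs_mul, abs_of_nonneg hs]
      rw [e1, ← sq_abs y]
      ring
    have h2 : 2 * Real.pi * |y| ≤ 1 := by
      calc 2 * Real.pi * |y| ≤ 2 * Real.pi * (1 / (2 * Real.pi)) := by gcongr
        _ = 1 := by field_simp
    rw [e]
    calc |s| * (2 * Real.pi * |y|) ^ 3 ≤ |s| * 1 ^ 3 := by gcongr
      _ = |s| := by ring
  have h3 : 0 ≤ (s * y) * (2 * Real.pi) ^ 3 * (2 * x ^ 2) := by positivity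
  nlinarith

/-- The Fourier transform of `e^{2πβx} W(s) φ`. -/
noncomputable def shifted (s β : ℝ) (ξ : R3) : ℂ :=
  cmultiplier s (ξ 0 + β * Complex.I) (ξ 1) (ξ 2) * phiHat (ξ 0 + β * Complex.I) (ξ 1) (ξ 2)

theorem continuous_shifted (s : ℝ) {β : ℝ} (hβ : |β| ≤ 1 / (2 * Real.pi)) :
    Continuous (shifted s β) := by
  unfold shifted cmultiplier phiHat
  refine Continuous.mul (by fun_prop) (Continuous.div (by fun_prop) (by fun_prop) fun ξ => ?_)
  exact pow_ne_zero _ (phiHat_den_ne_zero hβ)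

theorem norm_shifted_le {s β : ℝ} (hβ : |β| ≤ 1 / (2 * Real.pi)) (hs : 0 ≤ s * β) (ξ : R3) :
    ‖shifted s β ξ‖ ≤ 2 * Real.pi * Real.exp |s| *
      (Real.exp (-(s * β) * (2 * Real.pi) ^ 3 * ‖ξ‖ ^ 2) * ((1 + ‖ξ‖ ^ 2) ^ 2)⁻¹) := by
  rw [shifted, norm_mul, norm_sq_R3]
  calc _ ≤ _ := mul_le_mul (norm_cmultiplier_le hβ hs) (norm_phiHat_le hβ) (norm_nonneg _)
        (by positivity)
    _ = _ := by ring

theorem integrable_shifted {s β : ℝ} (hβ : |β| ≤ 1 / (2 * Real.pi)) (hs : 0 ≤ s * β) :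
    Integrable (shifted s β) := by
  refine (integrable_one_add_norm_sq.const_mul (2 * Real.pi * Real.exp |s|)).mono'
    (continuous_shifted s hβ).aestronglyMeasurable (Filter.Eventually.of_forall fun ξ => ?_)
  refine (norm_shifted_le hβ hs ξ).trans ?_
  have : Real.exp (-(s * β) * (2 * Real.pi) ^ 3 * ‖ξ‖ ^ 2) ≤ 1 := by
    apply Real.exp_le_one_iff.2
    have : 0 ≤ (s * β) * (2 * Real.pi) ^ 3 * ‖ξ‖ ^ 2 := by positivity
    linarith
  have h3 : 0 ≤ ((1 + ‖ξ‖ ^ 2) ^ 2)⁻¹ := by positivity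
  gcongr
  exact mul_le_of_le_one_left h3 this

/-- The complexified integrand of `W(s) φ (v)`. -/
noncomputable def integrand (s : ℝ) (v : R3) (z : ℂ) (a b : ℝ) : ℂ :=
  Complex.exp (2 * Real.pi * (z * v 0 + a * v 1 + b * v 2) * Complex.I) *
    (cmultiplier s z a b * phiHat z a b)

theorem integrand_shift (s β : ℝ) (v ξ : R3) :
    integrand s v (ξ 0 + β * Complex.I) (ξ 1) (ξ 2) =
      Complex.exp (-(2 * Real.pi * β * v 0)) *
        (Complex.exp (↑(2 * Real.pi * inner ℝ ξ v) * Complex.I) • shifted s β ξ) := by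
  rw [integrand, shifted, smul_eq_mul, ← mul_assoc (Complex.exp _) (Complex.exp _),
    ← Complex.exp_add, inner_R3]
  congr 2
  push_cast
  linear_combination (2 * Real.pi * β * v 0 : ℂ) * Complex.I_sq

/-- The bound is uniform in the height `y`, so it serves both for integrability along horizontal
lines and for the vanishing of the vertical sides. -/
theorem norm_integrand_le {s : ℝ} {v : R3} {x y a b : ℝ} (hy : |y| ≤ 1 / (2 * Real.pi))
    (hs : 0 ≤ s * y) :
    ‖integrand s v (x + y * Complex.I) a b‖ ≤
      2 * Real.pi * Real.exp |v 0| * Real.exp |s| * (1 + x ^ 2)⁻¹ := by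
  have e : (2 * Real.pi * ((x + y * Complex.I) * v 0 + a * v 1 + b * v 2) * Complex.I : ℂ).re =
      -(2 * Real.pi * y * v 0) := by
    have : (2 * Real.pi * ((x + y * Complex.I) * v 0 + a * v 1 + b * v 2) * Complex.I : ℂ) =
        ((-(2 * Real.pi * y * v 0) : ℝ) : ℂ) +
          ((2 * Real.pi * (x * v 0 + a * v 1 + b * v 2) : ℝ) : ℂ) * Complex.I := by
      push_cast
      linear_combination (2 * Real.pi * y * v 0 : ℂ) * Complex.I_sq
    rw [this]
    simp
  have h1 : -(2 * Real.pi * y * v 0) ≤ |v 0| := by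
    have h2 : 2 * Real.pi * |y| ≤ 1 := by
      calc 2 * Real.pi * |y| ≤ 2 * Real.pi * (1 / (2 * Real.pi)) := by gcongr
        _ = 1 := by field_simp
    calc -(2 * Real.pi * y * v 0) ≤ |2 * Real.pi * y * v 0| := neg_le_abs _
      _ = 2 * Real.pi * |y| * |v 0| := by
        rw [abs_mul, abs_mul, abs_of_pos Real.two_pi_pos]
      _ ≤ 1 * |v 0| := by gcongr
      _ = |v 0| := one_mul _
  have h2 : ‖cmultiplier s (x + y * Complex.I) a b‖ ≤ Real.exp |s| := by
    refine (norm_cmultiplier_le hy hs).trans (mul_le_of_le_one_right (Real.exp_nonneg _) ?_)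
    apply Real.exp_le_one_iff.2
    have : 0 ≤ (s * y) * (2 * Real.pi) ^ 3 * (x ^ 2 + a ^ 2 + b ^ 2) := by positivity
    linarith
  have h3 : ‖phiHat (x + y * Complex.I) a b‖ ≤ 2 * Real.pi * (1 + x ^ 2)⁻¹ := by
    refine (norm_phiHat_le hy).trans ?_
    gcongr
    nlinarith [sq_nonneg x, sq_nonneg a, sq_nonneg b]
  rw [integrand, norm_mul, norm_mul, Complex.norm_exp, e]
  calc _ ≤ Real.exp |v 0| * (Real.exp |s| * (2 * Real.pi * (1 + x ^ 2)⁻¹)) := by gcongr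
    _ = _ := by ring

theorem differentiableOn_integrand (s : ℝ) (v : R3) (a b : ℝ) :
    DifferentiableOn ℂ (fun z => integrand s v z a b) {z | |z.im| ≤ 1 / (2 * Real.pi)} := by
  intro z hz
  unfold integrand cmultiplier phiHat
  have hden : (1 + (Real.pi : ℂ) ^ 2 * (z ^ 2 + a ^ 2 + b ^ 2)) ^ 2 ≠ 0 := by
    have := phiHat_den_ne_zero (x := z.re) (a := a) (b := b) hz
    rw [Complex.re_add_im] at this
    exact pow_ne_zero _ this
  apply DifferentiableAt.differentiableWithinAt
  exact DifferentiableAt.mul (by fun_prop)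
    (DifferentiableAt.mul (by fun_prop) (DifferentiableAt.div (by fun_prop) (by fun_prop) hden))

theorem integral_integrand_shift {s β : ℝ} (hβ : |β| ≤ 1 / (2 * Real.pi)) (hs : 0 ≤ s * β)
    (v : R3) (a b : ℝ) :
    ∫ x : ℝ, integrand s v x a b = ∫ x : ℝ, integrand s v (x + β * Complex.I) a b := by
  -- Heights between `0` and `β` stay in the strip and never make `s * y` negative, so no
  -- intermediate line meets exponential growth.
  have hmem : ∀ y ∈ Set.uIcc 0 β, |y| ≤ 1 / (2 * Real.pi) ∧ 0 ≤ s * y := by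
    intro y hy
    rcases le_total 0 β with h | h
    · rw [Set.uIcc_of_le h] at hy
      rw [abs_of_nonneg h] at hβ
      refine ⟨by rw [abs_of_nonneg hy.1]; exact hy.2.trans hβ, ?_⟩
      rcases hy.1.eq_or_lt with h0 | h0
      · simp [← h0]
      · exact mul_nonneg (nonneg_of_mul_nonneg_left hs (h0.trans_le hy.2)) h0.le
    · rw [Set.uIcc_of_ge h] at hy
      rw [abs_of_nonpos h] at hβ
      refine ⟨by rw [abs_of_nonpos hy.2]; linarith [hy.1], ?_⟩
      rcases hy.2.eq_or_lt with h0 | h0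
      · simp [h0]
      · exact mul_nonneg_of_nonpos_of_nonpos (nonpos_of_mul_nonneg_left hs (hy.1.trans_lt h0)) h0.le
  set C := 2 * Real.pi * Real.exp |v 0| * Real.exp |s| with hC
  have hI : ∀ y ∈ Set.uIcc 0 β, Integrable fun x : ℝ => integrand s v (x + y * Complex.I) a b := by
    intro y hy
    refine (integrable_inv_one_add_sq.const_mul C).mono' ?_ (Filter.Eventually.of_forall fun x =>
      norm_integrand_le (hmem y hy).1 (hmem y hy).2)
    refine Continuous.aestronglyMeasurable ?_
    refine (differentiableOn_integrand s v a b).continuousOn.comp_continuous (by fun_prop) ?_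
    intro x
    simpa using (hmem y hy).1
  have ht : Filter.Tendsto (fun x : ℝ => C * (1 + x ^ 2)⁻¹) Filter.atTop (nhds 0) := by
    have : Filter.Tendsto (fun x : ℝ => 1 + x ^ 2) Filter.atTop Filter.atTop :=
      Filter.tendsto_atTop_add_const_left _ _ (Filter.tendsto_pow_atTop two_ne_zero)
    simpa using this.inv_tendsto_atTop.const_mul C
  refine integral_eq_integral_add_mul_I (f := fun z => integrand s v z a b)
    ((differentiableOn_integrand s v a b).mono fun z hz => (hmem _ hz).1)
    (fun x y hy => norm_integrand_le (hmem y hy).1 (hmem y hy).2) ht ?_ ?_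
    (hI β Set.right_mem_uIcc)
  · have := ht.comp Filter.tendsto_neg_atBot_atTop
    simpa [Function.comp_def] using this
  · simpa using hI 0 Set.left_mem_uIcc

/-- The gain of regularity: up to an exponential weight, `W(s) φ` is the inverse Fourier transform
of a function with Gaussian decay. -/
theorem fourierInv_multiplier_phiHat {s β : ℝ} (hβ : |β| ≤ 1 / (2 * Real.pi)) (hs : 0 ≤ s * β)
    (v : R3) :
    𝓕⁻ (fun ξ : R3 => multiplier s ξ * phiHat (ξ 0) (ξ 1) (ξ 2)) v =
      Complex.exp (-(2 * Real.pi * β * v 0)) * 𝓕⁻ (shifted s β) v := by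
  have hint : ∀ γ : ℝ, |γ| ≤ 1 / (2 * Real.pi) → 0 ≤ s * γ → Integrable fun p : ℝ × ℝ × ℝ =>
      integrand s v (p.1 + γ * Complex.I) p.2.1 p.2.2 := by
    intro γ h1 h2
    rw [← integrable_coords]
    simp_rw [integrand_shift]
    refine Integrable.const_mul ?_ _
    refine (integrable_shifted h1 h2).mono (Continuous.aestronglyMeasurable ?_)
      (Filter.Eventually.of_forall fun ξ => ?_)
    · have hc : Continuous fun ξ : R3 =>
          Complex.exp (↑(2 * Real.pi * inner ℝ ξ v) * Complex.I) := by fun_prop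
      exact hc.smul (continuous_shifted s h1)
    · rw [norm_smul, Complex.norm_exp_ofReal_mul_I, one_mul]
  have hzero : Integrable fun p : ℝ × ℝ × ℝ => integrand s v p.1 p.2.1 p.2.2 := by
    simpa using hint 0 (by simp [Real.pi_pos.le]) (by simp)
  have hl : 𝓕⁻ (fun ξ : R3 => multiplier s ξ * phiHat (ξ 0) (ξ 1) (ξ 2)) v =
      ∫ p : ℝ × ℝ × ℝ, integrand s v p.1 p.2.1 p.2.2 := by
    rw [Real.fourierInv_eq', ← integral_coords (fun p => integrand s v p.1 p.2.1 p.2.2)]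
    refine integral_congr_ae (Filter.Eventually.of_forall fun ξ => ?_)
    simp only [multiplier_eq, integrand, inner_R3, smul_eq_mul]
    push_cast
    rfl
  have hr : Complex.exp (-(2 * Real.pi * β * v 0)) * 𝓕⁻ (shifted s β) v =
      ∫ p : ℝ × ℝ × ℝ, integrand s v (p.1 + β * Complex.I) p.2.1 p.2.2 := by
    rw [Real.fourierInv_eq', ← integral_const_mul,
      ← integral_coords (fun p => integrand s v (p.1 + β * Complex.I) p.2.1 p.2.2)]
    exact integral_congr_ae (Filter.Eventually.of_forall fun ξ => (integrand_shift s β v ξ).symm)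
  -- Fubini in the order that makes the first frequency innermost, where the one-dimensional shift
  -- applies.
  rw [hl, hr, Measure.volume_eq_prod, integral_prod_symm _ hzero,
    integral_prod_symm _ (hint β hβ hs)]
  refine integral_congr_ae (Filter.Eventually.of_forall fun p => ?_)
  exact integral_integrand_shift hβ hs v p.1 p.2

/-! ### Derivative bounds from Fourier moments. -/

theorem norm_fourierInv_le (f : R3 → ℂ) (v : R3) : ‖𝓕⁻ f v‖ ≤ ∫ ξ, ‖f ξ‖ := by
  rw [Real.fourierInv_eq]
  refine (norm_integral_le_integral_norm _).trans_eq ?_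
  simp_rw [Circle.norm_smul]

theorem integrable_moment_comp_neg {f : R3 → ℂ}
    (hf : ∀ n : ℕ, Integrable fun ξ : R3 => ‖ξ‖ ^ n * ‖f ξ‖) (n : ℕ) :
    Integrable fun ξ : R3 => ‖ξ‖ ^ n * ‖f (-ξ)‖ := by
  simpa using (hf n).comp_neg

theorem contDiff_fourierInv {f : R3 → ℂ}
    (hf : ∀ n : ℕ, Integrable fun ξ : R3 => ‖ξ‖ ^ n * ‖f ξ‖) :
    ContDiff ℝ (⊤ : ℕ∞) (𝓕⁻ f) := by
  rw [Real.fourierInv_eq_fourier_comp_neg]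
  exact Real.contDiff_fourier fun n _ => integrable_moment_comp_neg hf n

theorem norm_iteratedFDeriv_fourierInv_le {f : R3 → ℂ}
    (hf : ∀ n : ℕ, Integrable fun ξ : R3 => ‖ξ‖ ^ n * ‖f ξ‖) (hm : Continuous f) (k : ℕ) (v : R3) :
    ‖iteratedFDeriv ℝ k (𝓕⁻ f) v‖ ≤ (2 * Real.pi) ^ k * ∫ ξ : R3, ‖ξ‖ ^ k * ‖f ξ‖ := by
  rw [Real.fourierInv_eq_fourier_comp_neg, Real.iteratedFDeriv_fourier (N := (⊤ : ℕ∞))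
    (fun n _ => integrable_moment_comp_neg hf n)
    (hm.comp continuous_neg).aestronglyMeasurable le_top, Real.fourier_eq]
  refine (norm_integral_le_integral_norm _).trans ?_
  simp_rw [Circle.norm_smul]
  have e : ∫ ξ : R3, ‖ξ‖ ^ k * ‖f ξ‖ = ∫ ξ : R3, ‖ξ‖ ^ k * ‖f (-ξ)‖ := by
    rw [← integral_neg_eq_self]
    simp
  rw [e, ← integral_const_mul]
  refine integral_mono_of_nonneg (Filter.Eventually.of_forall fun ξ => norm_nonneg _)
    ((integrable_moment_comp_neg hf k).const_mul _) (Filter.Eventually.of_forall fun ξ => ?_)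
  refine (VectorFourier.norm_fourierPowSMulRight_le _ _ _ _).trans ?_
  have : (2 * Real.pi * ‖innerSL (E := R3) ℝ‖) ≤ 2 * Real.pi :=
    mul_le_of_le_one_right Real.two_pi_pos.le (norm_innerSL_le ℝ)
  dsimp only
  rw [mul_assoc]
  gcongr

/-- The inequality `u^k / k! ≤ e^u` at `u = |s|(1 + |ξ|²)` trades `|ξ|^k` for `|s|^{-k}` and a
factor that the Gaussian absorbs. Of the exponent `2|s|` that remains, one `|s|` is the `1` in `u`,
the other comes from `norm_cmultiplier_le`. -/
theorem norm_pow_mul_norm_shifted_le {s β : ℝ} (hβ : |β| = 1 / (2 * Real.pi)) (hs : 0 < s * β)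
    (k : ℕ) (ξ : R3) :
    ‖ξ‖ ^ k * ‖shifted s β ξ‖ ≤
      2 * Real.pi * k.factorial * Real.exp (2 * |s|) * |s|⁻¹ ^ k * ((1 + ‖ξ‖ ^ 2) ^ 2)⁻¹ := by
  have hs0 : 0 < |s| := abs_pos.2 (left_ne_zero_of_mul hs.ne')
  have hu : 0 ≤ ‖ξ‖ ^ 2 := by positivity
  have e : s * β * (2 * Real.pi) ^ 3 = |s| * (2 * Real.pi) ^ 2 := by
    rw [← abs_of_pos hs, abs_mul, hβ]
    field_simp
  have h1 : ‖ξ‖ ^ k ≤ (1 + ‖ξ‖ ^ 2) ^ k := by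
    gcongr
    nlinarith [sq_nonneg (‖ξ‖ - 1)]
  have h2 : (1 + ‖ξ‖ ^ 2) ^ k ≤ k.factorial * Real.exp (|s| * (1 + ‖ξ‖ ^ 2)) * |s|⁻¹ ^ k := by
    have h := Real.pow_div_factorial_le_exp (|s| * (1 + ‖ξ‖ ^ 2)) (by positivity) k
    rw [div_le_iff₀ (by positivity), mul_pow] at h
    calc (1 + ‖ξ‖ ^ 2) ^ k = (|s| ^ k * (1 + ‖ξ‖ ^ 2) ^ k) * |s|⁻¹ ^ k := by
          rw [inv_pow]; field_simp
      _ ≤ (Real.exp (|s| * (1 + ‖ξ‖ ^ 2)) * k.factorial) * |s|⁻¹ ^ k := by gcongr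
      _ = _ := by ring
  have h3 : Real.exp (-(s * β) * (2 * Real.pi) ^ 3 * ‖ξ‖ ^ 2) ≤ Real.exp (-|s| * ‖ξ‖ ^ 2) := by
    apply Real.exp_le_exp.2
    have h4 : (1 : ℝ) ≤ (2 * Real.pi) ^ 2 := by nlinarith [Real.pi_gt_three]
    have h5 : |s| * ‖ξ‖ ^ 2 * 1 ≤ |s| * ‖ξ‖ ^ 2 * (2 * Real.pi) ^ 2 := by gcongr
    nlinarith
  calc ‖ξ‖ ^ k * ‖shifted s β ξ‖ ≤
      (k.factorial * Real.exp (|s| * (1 + ‖ξ‖ ^ 2)) * |s|⁻¹ ^ k) * (2 * Real.pi * Real.exp |s| *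
        (Real.exp (-|s| * ‖ξ‖ ^ 2) * ((1 + ‖ξ‖ ^ 2) ^ 2)⁻¹)) := by
        refine mul_le_mul (h1.trans h2) ((norm_shifted_le hβ.le hs.le ξ).trans ?_)
          (norm_nonneg _) (by positivity)
        gcongr
    _ = 2 * Real.pi * k.factorial * (Real.exp (|s| * (1 + ‖ξ‖ ^ 2)) * Real.exp |s| *
        Real.exp (-|s| * ‖ξ‖ ^ 2)) * |s|⁻¹ ^ k * ((1 + ‖ξ‖ ^ 2) ^ 2)⁻¹ := by ring
    _ = _ := by
      rw [← Real.exp_add, ← Real.exp_add]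
      congr 4
      ring

theorem integrable_moment_shifted {s β : ℝ} (hβ : |β| = 1 / (2 * Real.pi)) (hs : 0 < s * β)
    (k : ℕ) : Integrable fun ξ : R3 => ‖ξ‖ ^ k * ‖shifted s β ξ‖ := by
  refine (integrable_one_add_norm_sq.const_mul
    (2 * Real.pi * k.factorial * Real.exp (2 * |s|) * |s|⁻¹ ^ k)).mono'
    (Continuous.aestronglyMeasurable ?_) (Filter.Eventually.of_forall fun ξ => ?_)
  · exact (continuous_norm.pow k).mul (continuous_shifted s hβ.le).norm
  · rw [Real.norm_of_nonneg (by positivity)]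
    exact norm_pow_mul_norm_shifted_le hβ hs k ξ

/-- The constant in the bound on the derivatives of order `k`. -/
noncomputable def derivConst (k : ℕ) : ℝ :=
  (2 * Real.pi) ^ k * (2 * Real.pi * k.factorial * ∫ ξ : R3, ((1 + ‖ξ‖ ^ 2) ^ 2)⁻¹)

theorem derivConst_nonneg (k : ℕ) : 0 ≤ derivConst k := by
  have : 0 ≤ ∫ ξ : R3, ((1 + ‖ξ‖ ^ 2) ^ 2)⁻¹ := integral_nonneg fun ξ => by positivity
  unfold derivConst
  positivity

theorem norm_iteratedFDeriv_shifted_le {s β : ℝ} (hβ : |β| = 1 / (2 * Real.pi)) (hs : 0 < s * β)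
    (k : ℕ) (v : R3) :
    ‖iteratedFDeriv ℝ k (𝓕⁻ (shifted s β)) v‖ ≤
      derivConst k * (Real.exp (2 * |s|) * |s|⁻¹ ^ k) := by
  refine (norm_iteratedFDeriv_fourierInv_le (integrable_moment_shifted hβ hs)
    (continuous_shifted s hβ.le) k v).trans ?_
  calc _ ≤ (2 * Real.pi) ^ k * ∫ ξ : R3, 2 * Real.pi * k.factorial * Real.exp (2 * |s|) *
        |s|⁻¹ ^ k * ((1 + ‖ξ‖ ^ 2) ^ 2)⁻¹ := by
        gcongr ?_ * ?_
        exact integral_mono (integrable_moment_shifted hβ hs k)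
          (integrable_one_add_norm_sq.const_mul _)
          fun ξ => norm_pow_mul_norm_shifted_le hβ hs k ξ
    _ = _ := by
      rw [integral_const_mul, derivConst]
      ring

/-! ### Weights against small denominators. -/

/-- The coefficient `e^{-e^k} e^{-j²}`. -/
noncomputable def coeff (p : CoprimePair) : ℝ :=
  Real.exp (-Real.exp ((p.1.1 : ℕ) : ℝ)) * Real.exp (-(((p.1.2 : ℕ) : ℝ) ^ 2))

/-- The time `t - j/k` that has passed, at time `t`, since the singularity of the term `(k, j)`. -/
noncomputable def elapsed (t : ℝ) (p : CoprimePair) : ℝ :=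
  t - ((p.1.2 : ℕ) : ℝ) / ((p.1.1 : ℕ) : ℝ)

theorem coeff_pos (p : CoprimePair) : 0 < coeff p := by
  unfold coeff
  positivity

theorem summable_exp_neg_exp_mul_pow (N : ℕ) :
    Summable fun k : ℕ+ => Real.exp (-Real.exp ((k : ℕ) : ℝ)) * ((k : ℕ) : ℝ) ^ N := by
  have h : Summable fun k : ℕ => Real.exp (-Real.exp (k : ℝ)) * (k : ℝ) ^ N := by
    refine Summable.of_nonneg_of_le (fun k => by positivity) (fun k => ?_)
      (Real.summable_pow_mul_exp_neg_nat_mul N one_pos)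
    rw [mul_comm]
    gcongr
    linarith [Real.add_one_le_exp (k : ℝ)]
  exact h.comp_injective PNat.coe_injective

theorem summable_exp_neg_sq :
    Summable fun j : ℕ+ => Real.exp (-(((j : ℕ) : ℝ) ^ 2)) * Real.exp (2 * ((j : ℕ) : ℝ)) := by
  have h : Summable fun j : ℕ => Real.exp (-((j : ℝ) ^ 2)) * Real.exp (2 * (j : ℝ)) := by
    refine Summable.of_nonneg_of_le (fun k => by positivity) (fun j => ?_)
      -- `-j² + 2j ≤ 9/4 - j` is `(j - 3/2)² ≥ 0`.
      (Real.summable_exp_neg_nat.mul_left (Real.exp (9 / 4)))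
    rw [← Real.exp_add, ← Real.exp_add]
    apply Real.exp_le_exp.2
    nlinarith [sq_nonneg ((j : ℝ) - 3 / 2)]
  exact h.comp_injective PNat.coe_injective

theorem summable_coeff_mul (N : ℕ) :
    Summable fun p : CoprimePair =>
      coeff p * (Real.exp (2 * ((p.1.2 : ℕ) : ℝ)) * ((p.1.1 : ℕ) : ℝ) ^ N) := by
  have h := ((summable_exp_neg_exp_mul_pow N).mul_of_nonneg summable_exp_neg_sq
    (fun k => by positivity) (fun j => by positivity)).comp_injective
    (Subtype.val_injective (p := fun p : ℕ+ × ℕ+ => Nat.Coprime (p.2 : ℕ) (p.1 : ℕ)))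
  refine h.congr fun p => ?_
  simp only [Function.comp_apply, coeff]
  ring

theorem summable_coeff : Summable coeff := by
  refine Summable.of_nonneg_of_le (fun p => (coeff_pos p).le) (fun p => ?_) (summable_coeff_mul 0)
  rw [pow_zero, mul_one]
  exact le_mul_of_one_le_right (coeff_pos p).le (Real.one_le_exp (by positivity))

/-- `t` is not approximated too well by the fractions `j/k` different from `t`. -/
def Diophantine (t : ℝ) : Prop :=
  ∃ (C : ℝ) (n : ℕ), ∀ p : CoprimePair, elapsed t p ≠ 0 →
    |elapsed t p|⁻¹ ≤ C * ((p.1.1 : ℕ) : ℝ) ^ n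

theorem abs_elapsed_le (t : ℝ) (p : CoprimePair) : |elapsed t p| ≤ |t| + ((p.1.2 : ℕ) : ℝ) := by
  have hk : (1 : ℝ) ≤ ((p.1.1 : ℕ) : ℝ) := by exact_mod_cast p.1.1.pos
  have hj : (0 : ℝ) ≤ ((p.1.2 : ℕ) : ℝ) := by positivity
  refine (abs_sub _ _).trans ?_
  gcongr
  rw [abs_of_nonneg (by positivity)]
  exact div_le_self hj hk

/-- The factor `e^{2|s|}` grows at most like `e^{2j}` and is beaten by `e^{-j²}`; `|s|^{-m}` is
polynomial in `k` and is beaten by `e^{-e^k}`. -/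
theorem summable_coeff_mul_elapsed {t : ℝ} (ht : Diophantine t) (m : ℕ) :
    Summable fun p : CoprimePair =>
      coeff p * (Real.exp (2 * |elapsed t p|) * |elapsed t p|⁻¹ ^ m) := by
  obtain ⟨C, n, h⟩ := ht
  have hmain := (summable_coeff_mul (n * m)).mul_left (Real.exp (2 * |t|) * (|C| + 1) ^ m)
  refine Summable.of_nonneg_of_le
    (fun p => mul_nonneg (coeff_pos p).le (by positivity)) (fun p => ?_) hmain
  have hk : (0 : ℝ) ≤ ((p.1.1 : ℕ) : ℝ) := by positivity
  have h1 : |elapsed t p|⁻¹ ≤ (|C| + 1) * ((p.1.1 : ℕ) : ℝ) ^ n := by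
    -- A vanishing elapsed time has inverse `0` by convention, so the bound survives; `|C| + 1`
    -- keeps the right side nonnegative.
    by_cases h0 : elapsed t p = 0
    · rw [h0]
      simp only [abs_zero, inv_zero]
      positivity
    · refine (h p h0).trans ?_
      gcongr
      linarith [le_abs_self C]
  have h2 : Real.exp (2 * |elapsed t p|) ≤
      Real.exp (2 * |t|) * Real.exp (2 * ((p.1.2 : ℕ) : ℝ)) := by
    rw [← Real.exp_add]
    apply Real.exp_le_exp.2
    linarith [abs_elapsed_le t p]
  have hc := coeff_pos p
  calc coeff p * (Real.exp (2 * |elapsed t p|) * |elapsed t p|⁻¹ ^ m) ≤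
      coeff p * ((Real.exp (2 * |t|) * Real.exp (2 * ((p.1.2 : ℕ) : ℝ))) *
        ((|C| + 1) * ((p.1.1 : ℕ) : ℝ) ^ n) ^ m) := by gcongr
    _ = _ := by
      rw [mul_pow, pow_mul]
      ring

/-! ### Splitting `W(t)u₀` into a smooth part and a multiple of `φ`. -/

/-- The contribution of `p` to the smooth part with exponential weight of rate `2πβ`. -/
noncomputable def smoothTerm (t β : ℝ) (p : CoprimePair) (v : R3) : ℂ :=
  if 0 < elapsed t p * β then (coeff p : ℂ) * 𝓕⁻ (shifted (elapsed t p) β) v else 0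

theorem contDiff_smoothTerm {t β : ℝ} (hβ : |β| = 1 / (2 * Real.pi)) (p : CoprimePair) :
    ContDiff ℝ (⊤ : ℕ∞) (smoothTerm t β p) := by
  unfold smoothTerm
  by_cases h : 0 < elapsed t p * β
  · simp only [h, if_true]
    exact contDiff_const.mul (contDiff_fourierInv (integrable_moment_shifted hβ h))
  · simp only [h, if_false]
    exact contDiff_const

theorem norm_iteratedFDeriv_smoothTerm_le {t β : ℝ} (hβ : |β| = 1 / (2 * Real.pi)) (k : ℕ)
    (p : CoprimePair) (v : R3) :
    ‖iteratedFDeriv ℝ k (smoothTerm t β p) v‖ ≤ derivConst k *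
      (coeff p * (Real.exp (2 * |elapsed t p|) * |elapsed t p|⁻¹ ^ k)) := by
  have hc := (coeff_pos p).le
  have hd := derivConst_nonneg k
  unfold smoothTerm
  by_cases h : 0 < elapsed t p * β
  · simp only [h, if_true]
    have hsmul : (fun v => (coeff p : ℂ) * 𝓕⁻ (shifted (elapsed t p) β) v) =
        (coeff p : ℂ) • 𝓕⁻ (shifted (elapsed t p) β) := rfl
    have hcd : ContDiff ℝ (⊤ : ℕ∞) (𝓕⁻ (shifted (elapsed t p) β)) :=
      contDiff_fourierInv (integrable_moment_shifted hβ h)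
    rw [hsmul, iteratedFDeriv_const_smul_apply (hcd.of_le (by exact_mod_cast le_top)).contDiffAt,
      norm_smul, Complex.norm_real, Real.norm_of_nonneg hc]
    calc _ ≤ coeff p * (derivConst k *
          (Real.exp (2 * |elapsed t p|) * |elapsed t p|⁻¹ ^ k)) := by
          gcongr
          exact norm_iteratedFDeriv_shifted_le hβ h k v
      _ = _ := by ring
  · simp only [h, if_false]
    have : iteratedFDeriv ℝ k (fun _ : R3 => (0 : ℂ)) v = 0 := by
      change iteratedFDeriv ℝ k (0 : R3 → ℂ) v = 0
      rw [iteratedFDeriv_zero]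
      rfl
    rw [this, norm_zero]
    positivity

theorem contDiff_tsum_smoothTerm {t β : ℝ} (ht : Diophantine t) (hβ : |β| = 1 / (2 * Real.pi)) :
    ContDiff ℝ (⊤ : ℕ∞) fun v => ∑' p, smoothTerm t β p v :=
  contDiff_tsum (fun p => contDiff_smoothTerm hβ p)
    (fun k _ => (summable_coeff_mul_elapsed ht k).mul_left (derivConst k))
    (fun k p v _ => norm_iteratedFDeriv_smoothTerm_le hβ k p v)

theorem summable_smoothTerm {t β : ℝ} (ht : Diophantine t) (hβ : |β| = 1 / (2 * Real.pi))
    (v : R3) : Summable fun p => smoothTerm t β p v := by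
  refine Summable.of_norm_bounded ((summable_coeff_mul_elapsed ht 0).mul_left (derivConst 0))
    fun p => ?_
  rw [← norm_iteratedFDeriv_zero (𝕜 := ℝ) (f := smoothTerm t β p)]
  exact norm_iteratedFDeriv_smoothTerm_le hβ 0 p v

/-- The pointwise representative of `W(s) φ`. -/
noncomputable def evolved (s : ℝ) : R3 → ℂ :=
  𝓕⁻ fun ξ : R3 => multiplier s ξ * phiHat (ξ 0) (ξ 1) (ξ 2)

theorem W_phi_ae_eq (s : ℝ) : (W s phi : R3 → ℂ) =ᵐ[volume] evolved s :=
  W_ae_eq s integrable_phiHat memLp_phiHat phi_eq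

theorem norm_evolved_le (s : ℝ) (v : R3) :
    ‖evolved s v‖ ≤ ∫ ξ : R3, ‖phiHat (ξ 0) (ξ 1) (ξ 2)‖ := by
  refine (norm_fourierInv_le _ v).trans_eq ?_
  simp [norm_multiplier]

theorem evolved_zero (v : R3) : evolved 0 v = phiFun v := by
  rw [← fourierInv_phiHat, evolved]
  simp [multiplier]

theorem term_eq (p : CoprimePair) :
    term p = (coeff p : ℂ) • W (-(((p.1.2 : ℕ) : ℝ) / ((p.1.1 : ℕ) : ℝ))) phi := rfl

theorem summable_term : Summable term := by
  refine Summable.of_norm_bounded (summable_coeff.mul_right ‖phi‖) fun p => ?_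
  rw [term_eq, norm_smul, Complex.norm_real, Real.norm_of_nonneg (coeff_pos p).le]
  exact (congrArg (coeff p * ·) ((Wₗᵢ _).norm_map phi)).le

theorem W_zero (f : L2) : W 0 f = f := by
  have : ((memLp_multiplier_mul 0 (𝓕 f)).toLp _ : L2) = 𝓕 f := by
    rw [Lp.ext_iff]
    refine (MemLp.coeFn_toLp _).trans (Filter.Eventually.of_forall fun ξ => ?_)
    simp [multiplier]
  rw [W, this, FourierTransform.fourierInv_fourier_eq]

theorem W_u0_ae_eq (t : ℝ) :
    (W t u0 : R3 → ℂ) =ᵐ[volume] fun v => ∑' p, (coeff p : ℂ) * evolved (elapsed t p) v := by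
  have hterm : ∀ p, W t (term p) = (coeff p : ℂ) • W (elapsed t p) phi := by
    intro p
    rw [term_eq]
    refine ((Wₗᵢ t).map_smul _ _).trans ?_
    congr 1
    exact W_W _ _ _
  have hW : W t u0 = ∑' p, (coeff p : ℂ) • W (elapsed t p) phi := by
    refine ((Wₗᵢ t).toContinuousLinearMap.map_tsum summable_term).trans ?_
    exact tsum_congr hterm
  have hsum : Summable fun p => (coeff p : ℂ) • W (elapsed t p) phi := by
    refine ((Wₗᵢ t).toContinuousLinearMap.summable summable_term).congr hterm
  rw [hW]
  refine tsum_ae_eq_of_hasSum hsum (f := fun p v => (coeff p : ℂ) * evolved (elapsed t p) v)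
    (fun p => ?_) fun v => ?_
  · filter_upwards [Lp.coeFn_smul (coeff p : ℂ) (W (elapsed t p) phi),
      W_phi_ae_eq (elapsed t p)] with v h1 h2
    rw [h1, Pi.smul_apply, h2, smul_eq_mul]
  · refine (Summable.of_norm_bounded (summable_coeff.mul_right
      (∫ ξ : R3, ‖phiHat (ξ 0) (ξ 1) (ξ 2)‖)) fun p => ?_).hasSum
    rw [norm_mul, Complex.norm_real, Real.norm_of_nonneg (coeff_pos p).le]
    exact mul_le_mul_of_nonneg_left (norm_evolved_le _ _) (coeff_pos p).le

/-- The total weight of the terms that are singular at time `t`. -/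
noncomputable def singularWeight (t : ℝ) : ℝ := ∑' p, if elapsed t p = 0 then coeff p else 0

/-- The smooth part of `W(t) u₀`. -/
noncomputable def regularPart (t : ℝ) (v : R3) : ℂ :=
  Complex.exp (-(v 0 : ℂ)) * ∑' p, smoothTerm t (1 / (2 * Real.pi)) p v +
    Complex.exp (v 0 : ℂ) * ∑' p, smoothTerm t (-(1 / (2 * Real.pi))) p v

theorem summable_singularWeight (t : ℝ) :
    Summable fun p => if elapsed t p = 0 then coeff p else 0 := by
  refine Summable.of_nonneg_of_le (fun p => ?_) (fun p => ?_) summable_coeff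
  · split_ifs
    exacts [(coeff_pos p).le, le_rfl]
  · split_ifs
    exacts [le_rfl, (coeff_pos p).le]

theorem abs_inv_two_pi : |1 / (2 * Real.pi)| = 1 / (2 * Real.pi) :=
  abs_of_pos (by positivity)

theorem abs_neg_inv_two_pi : |-(1 / (2 * Real.pi))| = 1 / (2 * Real.pi) := by
  rw [abs_neg, abs_inv_two_pi]

theorem contDiff_regularPart {t : ℝ} (ht : Diophantine t) :
    ContDiff ℝ (⊤ : ℕ∞) (regularPart t) := by
  have h0 : ContDiff ℝ (⊤ : ℕ∞) fun v : R3 => (v 0 : ℂ) :=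
    Complex.ofRealCLM.contDiff.comp (by fun_prop : ContDiff ℝ (⊤ : ℕ∞) fun v : R3 => v 0)
  exact (h0.neg.cexp.mul (contDiff_tsum_smoothTerm ht abs_inv_two_pi)).add
    (h0.cexp.mul (contDiff_tsum_smoothTerm ht abs_neg_inv_two_pi))

/-- Exactly one of the three summands is nonzero, according to the sign of the elapsed time. Since
`2πβ = ±1`, the weights are `e^{∓x}`. -/
theorem coeff_mul_evolved (t : ℝ) (p : CoprimePair) (v : R3) :
    (coeff p : ℂ) * evolved (elapsed t p) v =
      Complex.exp (-(v 0 : ℂ)) * smoothTerm t (1 / (2 * Real.pi)) p v +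
      Complex.exp (v 0 : ℂ) * smoothTerm t (-(1 / (2 * Real.pi))) p v +
      ((if elapsed t p = 0 then coeff p else 0 : ℝ) : ℂ) * phiFun v := by
  have hpi : (0 : ℝ) < 1 / (2 * Real.pi) := by positivity
  have hpc : (Real.pi : ℂ) ≠ 0 := by exact_mod_cast Real.pi_ne_zero
  rcases lt_trichotomy (elapsed t p) 0 with h | h | h
  · have h1 : 0 < elapsed t p * -(1 / (2 * Real.pi)) := mul_pos_of_neg_of_neg h (by linarith)
    have h2 : ¬ 0 < elapsed t p * (1 / (2 * Real.pi)) := (mul_neg_of_neg_of_pos h hpi).not_gt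
    have e : -(2 * Real.pi * ((-(1 / (2 * Real.pi)) : ℝ) : ℂ) * v 0) = (v 0 : ℂ) := by
      push_cast
      field_simp
    rw [smoothTerm, smoothTerm, if_pos h1, if_neg h2, if_neg h.ne, evolved,
      fourierInv_multiplier_phiHat abs_neg_inv_two_pi.le h1.le, e]
    simp only [Complex.ofReal_zero]
    ring
  · rw [smoothTerm, smoothTerm, h, evolved_zero]
    simp
  · have h1 : 0 < elapsed t p * (1 / (2 * Real.pi)) := mul_pos h hpi
    have h2 : ¬ 0 < elapsed t p * -(1 / (2 * Real.pi)) :=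
      (mul_neg_of_pos_of_neg h (by linarith)).not_gt
    have e : -(2 * Real.pi * ((1 / (2 * Real.pi) : ℝ) : ℂ) * v 0) = -(v 0 : ℂ) := by
      push_cast
      field_simp
    rw [smoothTerm, smoothTerm, if_pos h1, if_neg h2, if_neg h.ne', evolved,
      fourierInv_multiplier_phiHat abs_inv_two_pi.le h1.le, e]
    simp only [Complex.ofReal_zero]
    ring

/-- At a Diophantine time, `W(t) u₀` is a smooth function plus a multiple of `φ`. -/
theorem W_u0_ae_eq_regularPart_add {t : ℝ} (ht : Diophantine t) :
    (W t u0 : R3 → ℂ) =ᵐ[volume] fun v => regularPart t v + singularWeight t * phiFun v := by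
  refine (W_u0_ae_eq t).trans (Filter.Eventually.of_forall fun v => ?_)
  have h1 := (summable_smoothTerm ht abs_inv_two_pi v).hasSum.mul_left (Complex.exp (-(v 0 : ℂ)))
  have h2 := (summable_smoothTerm ht abs_neg_inv_two_pi v).hasSum.mul_left (Complex.exp (v 0 : ℂ))
  have h3 := ((Complex.hasSum_ofReal.2 (summable_singularWeight t).hasSum)).mul_right (phiFun v)
  have h := (h1.add h2).add h3
  simp_rw [← coeff_mul_evolved] at h
  exact h.tsum_eq

/-! ### Regularity and its failure at Diophantine times. -/

theorem isCnOn_univ_of_elapsed_ne_zero {t : ℝ} (ht : Diophantine t)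
    (h0 : ∀ p, elapsed t p ≠ 0) : IsCnOn (⊤ : ℕ∞) (W t u0) Set.univ := by
  refine ⟨regularPart t, (contDiff_regularPart ht).contDiffOn, ?_⟩
  rw [Measure.restrict_univ]
  have hw : singularWeight t = 0 := by simp [singularWeight, h0]
  filter_upwards [W_u0_ae_eq_regularPart_add ht] with v hv
  rw [hv, hw]
  simp

theorem isCnOn_compl_zero {t : ℝ} (ht : Diophantine t) : IsCnOn (⊤ : ℕ∞) (W t u0) {0}ᶜ := by
  refine ⟨fun v => regularPart t v + singularWeight t * phiFun v, ?_,
    ae_restrict_of_ae (W_u0_ae_eq_regularPart_add ht)⟩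
  intro v hv
  refine ContDiffAt.contDiffWithinAt ?_
  refine (contDiff_regularPart ht).contDiffAt.add (contDiffAt_const.mul ?_)
  unfold phiFun
  have hn : ContDiffAt ℝ (⊤ : ℕ∞) (fun v : R3 => ‖v‖) v := contDiffAt_norm ℝ hv
  exact Complex.ofRealCLM.contDiff.contDiffAt.comp v (contDiffAt_const.mul hn).exp

/-- On the first axis, `-(1/2) log φ` is `|x|`. -/
theorem not_differentiable_phiFun : ¬ Differentiable ℝ phiFun := by
  intro h
  have hs : Differentiable ℝ fun x : ℝ => (EuclideanSpace.single 0 x : R3) := by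
    have : (fun x : ℝ => (EuclideanSpace.single 0 x : R3)) =
        fun x : ℝ => x • (EuclideanSpace.single 0 1 : R3) := by
      funext x
      ext i
      simp
    rw [this]
    fun_prop
  have h1 := Complex.reCLM.differentiable.comp (h.comp hs)
  have h2 : Complex.reCLM ∘ phiFun ∘ (fun x : ℝ => (EuclideanSpace.single 0 x : R3)) =
      fun x : ℝ => Real.exp (-2 * |x|) := by
    funext x
    simp [phiFun, -Complex.ofReal_exp]
  rw [h2] at h1
  have h3 : DifferentiableAt ℝ (fun x : ℝ => -(1 / 2) * Real.log (Real.exp (-2 * |x|))) 0 :=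
    ((h1 0).log (Real.exp_ne_zero _)).const_mul _
  refine not_differentiableAt_abs_zero (h3.congr_of_eventuallyEq
    (Filter.Eventually.of_forall fun x => ?_))
  simp only [Real.log_exp]
  ring

theorem singularWeight_pos {t : ℝ} {p : CoprimePair} (hp : elapsed t p = 0) :
    0 < singularWeight t := by
  refine (summable_singularWeight t).tsum_pos (fun p => ?_) p ?_
  · split_ifs
    exacts [(coeff_pos p).le, le_rfl]
  · rw [if_pos hp]
    exact coeff_pos p

/-- A `C¹` representative would agree everywhere with the continuous function `regularPart +
singularWeight * φ`; as the weight is positive, `φ` would be differentiable. -/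
theorem not_isCnOn_one {t : ℝ} (ht : Diophantine t) {p : CoprimePair} (hp : elapsed t p = 0) :
    ¬ IsCnOn 1 (W t u0) Set.univ := by
  rintro ⟨g, hg, hae⟩
  rw [Measure.restrict_univ] at hae
  have hg' : ContDiff ℝ 1 g := contDiffOn_univ.1 hg
  have hw : (singularWeight t : ℂ) ≠ 0 := by exact_mod_cast (singularWeight_pos hp).ne'
  have hR := contDiff_regularPart ht
  have hphi : Continuous phiFun := by unfold phiFun; fun_prop
  have heq : (fun v => regularPart t v + singularWeight t * phiFun v) = g := by
    refine (Continuous.ae_eq_iff_eq volume ?_ hg'.continuous).1 ?_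
    · exact hR.continuous.add (continuous_const.mul hphi)
    · filter_upwards [W_u0_ae_eq_regularPart_add ht, hae] with v h1 h2
      rw [← h1, h2]
  apply not_differentiable_phiFun
  have : phiFun = fun v => (singularWeight t : ℂ)⁻¹ * (g v - regularPart t v) := by
    funext v
    rw [← congrFun heq v]
    field_simp
    ring
  rw [this]
  exact ((hg'.differentiable (by norm_num)).sub
    (hR.differentiable (by simp))).const_mul _

/-! ### Which times are Diophantine. -/

/-- A nonzero difference of two fractions is at least the inverse of the product of their
denominators. -/
theorem diophantine_ratCast (q : ℚ) : Diophantine q := by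
  refine ⟨q.den, 1, fun p h => ?_⟩
  have hk : (0 : ℝ) < ((p.1.1 : ℕ) : ℝ) := by exact_mod_cast p.1.1.pos
  have hd : (0 : ℝ) < (q.den : ℝ) := by exact_mod_cast q.pos
  have e : elapsed q p = ((q.num * (p.1.1 : ℕ) - (p.1.2 : ℕ) * q.den : ℤ) : ℝ) /
      (q.den * ((p.1.1 : ℕ) : ℝ)) := by
    rw [elapsed]
    conv_lhs => rw [Rat.cast_def q]
    rw [div_sub_div _ _ hd.ne' hk.ne']
    push_cast
    ring
  have hn : (q.num * (p.1.1 : ℕ) - (p.1.2 : ℕ) * q.den : ℤ) ≠ 0 := by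
    intro h0
    rw [e, h0] at h
    simp at h
  have h1 : (1 : ℝ) ≤ |((q.num * (p.1.1 : ℕ) - (p.1.2 : ℕ) * q.den : ℤ) : ℝ)| := by
    exact_mod_cast Int.one_le_abs hn
  rw [e, abs_div, abs_of_pos (mul_pos hd hk), inv_div, pow_one]
  exact div_le_self (by positivity) h1

theorem diophantine_of_not_liouville {t : ℝ} (ht : ¬ Liouville t) : Diophantine t := by
  unfold Liouville at ht
  push Not at ht
  obtain ⟨n, hn⟩ := ht
  -- `Liouville` only concerns denominators above `1`, so `j/k` is written as `2j/(2k)` to include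
  -- `k = 1`; this costs the factor `2 ^ n`.
  refine ⟨2 ^ n, n, fun p h => ?_⟩
  have hk : 0 < (p.1.1 : ℕ) := p.1.1.pos
  have hk' : (0 : ℝ) < ((p.1.1 : ℕ) : ℝ) := by exact_mod_cast hk
  have e : t - ((2 * (p.1.2 : ℕ) : ℤ) : ℝ) / ((2 * (p.1.1 : ℕ) : ℤ) : ℝ) = elapsed t p := by
    rw [elapsed]
    push_cast
    rw [mul_div_mul_left _ _ two_ne_zero]
  have h1 := hn (2 * (p.1.2 : ℕ)) (2 * (p.1.1 : ℕ)) (by omega)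
    (fun h0 => h (by rw [← e]; exact sub_eq_zero.2 h0))
  rw [e] at h1
  have h2 : 0 < |elapsed t p| := abs_pos.2 h
  refine (inv_anti₀ (by positivity) h1).trans_eq ?_
  push_cast
  rw [one_div, inv_inv, mul_pow]

theorem IsGeneric.not_liouville {γ : ℝ} (h : IsGeneric γ) : ¬ Liouville γ := by
  intro hL
  obtain ⟨-, c, hc, hgen⟩ := h
  -- For a fraction `a/b` within `1` of `γ`, `|a| + b ≤ bM`.
  set M : ℝ := |γ| + 2 with hM
  have hM0 : 0 < M := by positivity
  obtain ⟨m, hm⟩ := pow_unbounded_of_one_lt (M ^ 2 / c) (one_lt_two (α := ℝ))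
  -- Of the `m + 3` powers of `b`, one is lost in passing from `γ - a/b` to `bγ - a` and two to `K
  -- log K ≤ (bM)²`. The remaining `b^m ≥ 2^m` exceeds `M²/c`.
  obtain ⟨a, b, hb, -, hlt⟩ := hL (m + 3)
  have hb' : (2 : ℝ) ≤ (b : ℝ) := by exact_mod_cast hb
  have hb0 : (0 : ℝ) < (b : ℝ) := by linarith
  have hbz : |b| = b := abs_of_pos (by omega)
  have hK2 : 2 ≤ |(-a)| + |b| := by
    rw [hbz]
    have := abs_nonneg (-a)
    omega
  have h1 := hgen (-a) b hK2
  set K : ℝ := ((|(-a)| + |b| : ℤ) : ℝ) with hK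
  have hKge : (2 : ℝ) ≤ K := by rw [hK]; exact_mod_cast hK2
  have hdist : |γ - a / b| ≤ 1 := hlt.le.trans (by
    rw [div_le_one (by positivity)]
    exact one_le_pow₀ (by linarith))
  have hKle : K ≤ b * M := by
    have e1 : K = |(a : ℝ)| + b := by rw [hK, hbz]; push_cast; rw [abs_neg]
    have e2 : |(a : ℝ)| = b * |(a : ℝ) / b| := by
      rw [abs_div, abs_of_pos hb0]; field_simp
    have e3 : |(a : ℝ) / b| ≤ |γ| + 1 := by
      calc |(a : ℝ) / b| = |γ - (γ - a / b)| := by ring_nf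
        _ ≤ |γ| + |γ - a / b| := abs_sub _ _
        _ ≤ |γ| + 1 := by gcongr
    rw [e1, e2, hM]
    nlinarith
  have hlog : Real.log K ≤ K := (Real.log_le_sub_one_of_pos (by linarith)).trans (by linarith)
  have hlogpos : 0 < Real.log K := Real.log_pos (by linarith)
  have h2 : c / (b * M) ^ 2 ≤ c / (K * Real.log K) := by
    gcongr
    calc K * Real.log K ≤ K * K := by gcongr
      _ ≤ (b * M) * (b * M) := by gcongr
      _ = (b * M) ^ 2 := by ring
  have h3 : |((-a : ℤ) : ℝ) + (b : ℝ) * γ| < b * (1 / (b : ℝ) ^ (m + 3)) := by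
    have : ((-a : ℤ) : ℝ) + (b : ℝ) * γ = b * (γ - a / b) := by
      push_cast
      field_simp
      ring
    rw [this, abs_mul, abs_of_pos hb0]
    gcongr
  have h4 : c / (b * M) ^ 2 < b * (1 / (b : ℝ) ^ (m + 3)) := (h2.trans h1).trans_lt h3
  have h5 : c * (b : ℝ) ^ m < M ^ 2 := by
    have e : (b : ℝ) * (1 / (b : ℝ) ^ (m + 3)) = 1 / ((b : ℝ) ^ m * b ^ 2) := by
      field_simp
      ring
    rw [e, mul_pow, div_lt_div_iff₀ (by positivity) (by positivity)] at h4
    have : (c * (b : ℝ) ^ m) * b ^ 2 < M ^ 2 * b ^ 2 := by linarith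
    exact lt_of_mul_lt_mul_right this (by positivity)
  have h6 : c * (2 : ℝ) ^ m ≤ c * (b : ℝ) ^ m := by gcongr
  rw [div_lt_iff₀ hc] at hm
  linarith

theorem exists_elapsed_eq_zero {q : ℚ} (hq : 0 < q) : ∃ p : CoprimePair, elapsed q p = 0 := by
  have hnum : 0 < q.num := Rat.num_pos.2 hq
  refine ⟨⟨(⟨q.den, q.pos⟩, ⟨q.num.natAbs, Int.natAbs_pos.2 hnum.ne'⟩), q.reduced⟩, ?_⟩
  have e : ((q.num.natAbs : ℕ) : ℝ) = (q.num : ℝ) := by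
    rw [Nat.cast_natAbs, abs_of_pos hnum]
  simp only [elapsed, PNat.mk_coe, e]
  rw [← Rat.cast_def, sub_self]

theorem elapsed_ne_zero_of_irrational {t : ℝ} (ht : Irrational t) (p : CoprimePair) :
    elapsed t p ≠ 0 := by
  rw [elapsed, sub_ne_zero]
  have := ht.ne_rat (((p.1.2 : ℕ) : ℚ) / ((p.1.1 : ℕ) : ℚ))
  push_cast at this
  exact this

theorem elapsed_zero_ne_zero (p : CoprimePair) : elapsed 0 p ≠ 0 := by
  have h1 : (0 : ℝ) < ((p.1.1 : ℕ) : ℝ) := by exact_mod_cast p.1.1.pos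
  have h2 : (0 : ℝ) < ((p.1.2 : ℕ) : ℝ) := by exact_mod_cast p.1.2.pos
  rw [elapsed, zero_sub, neg_ne_zero]
  positivity

end ZK

/-! ### The theorem. -/

theorem theorem1p2 :
    Summable ZK.term ∧
    ZK.IsCnOn (⊤ : ℕ∞) ZK.u0 Set.univ ∧
    ∃ X : Set ℝ,
      volume X = 0 ∧
      (∀ q : ℚ, (q : ℝ) ∈ X) ∧
      (∀ γ : ℝ, ZK.IsGeneric γ → γ ∉ X) ∧
      (∀ t : ℝ, 0 < t → t ∉ X → ZK.IsCnOn (⊤ : ℕ∞) (ZK.W t ZK.u0) Set.univ) ∧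
      (∀ q : ℚ, 0 < q →
        ZK.IsCnOn (⊤ : ℕ∞) (ZK.W (q : ℝ) ZK.u0) {0}ᶜ ∧
        ¬ ZK.IsCnOn 1 (ZK.W (q : ℝ) ZK.u0) Set.univ) := by
  refine ⟨ZK.summable_term, ?_, Set.range ((↑) : ℚ → ℝ) ∪ {x | Liouville x}, ?_, ?_, ?_, ?_, ?_⟩
  -- Time `0` is rational, hence Diophantine, and not singular, because every `j/k` in the sum is
  -- positive.
  · rw [← ZK.W_zero ZK.u0]
    refine ZK.isCnOn_univ_of_elapsed_ne_zero ?_ ZK.elapsed_zero_ne_zero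
    simpa using ZK.diophantine_ratCast 0
  · exact measure_union_null ((Set.countable_range _).measure_zero _) volume_setOfPred_liouville
  · exact fun q => Or.inl ⟨q, rfl⟩
  · rintro γ hγ (hq | hL)
    · exact hγ.1 hq
    · exact hγ.not_liouville hL
  · intro t _ hX
    exact ZK.isCnOn_univ_of_elapsed_ne_zero
      (ZK.diophantine_of_not_liouville fun h => hX (Or.inr h))
      (ZK.elapsed_ne_zero_of_irrational fun h => hX (Or.inl h))
  · intro q hq
    obtain ⟨p, hp⟩ := ZK.exists_elapsed_eq_zero hq
    exact ⟨ZK.isCnOn_compl_zero (ZK.diophantine_ratCast q),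
      ZK.not_isCnOn_one (ZK.diophantine_ratCast q) hp⟩
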